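/- **Setting.** There are $N$ players and $K$ arms, $1\le N\le K$. Every arm $a$ has a known strict preference list $\rho_a$ over all players. Whenever player $p$ is matched with arm $a$ in a sampled matching, $p$ observes a reward; for each pair $(p,a)$ these rewards are i.i.d. with an unknown law $\nu_{p,a}$ on $[0,1]$ with mean $\mu_{p,a}$. For each $p$ the means $\mu_{p,a}$ are pairwise distinct, and $p$'s true preference list $\pi_p$ orders the arms by decreasing mean. A matching is a set of pairwise disjoint player-arm pairs. It is stable if no pair outside it consists of a player and an arm each of which is unmatched or strictly prefers the other to its partner. DA denotes the player-proposing deferred acceptance algorithm. Let $0<\delta<1$ and $\epsilon_t=\sqrt{\ln(4KNt^2/\delta)/(2t)}$. **Improved Elimination Algorithm.** Initially $S_p$ is the set of all arms, for every $p$. In round $t=1,2,\dots$: 1. sample all matchings of a minimal matching cover of $E_t=\{(p,a):a\in S_p\}$, i.e. of a smallest family of matchings covering $E_t$, chosen so that each pair of $E_t$ is sampled exactly once and no other pair is sampled; 2. update the sample mean $\hat\mu_{p,a}$ of the pairs with $a\in S_p$ (the sample means of eliminated pairs stay fixed); 3. simultaneously remove from $S_p$ every $a\in S_p$ whose interval $[\hat\mu_{p,a}-\epsilon_t,\hat\mu_{p,a}+\epsilon_t]$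 is disjoint from the corresponding interval of every other arm available in $S_p$ at the start of this step; 4. let $\hat\pi_p$ order all arms by decreasing $\hat\mu_{p,a}$ (ties broken by any fixed rule), and let $m_t=\mathrm{DA}(\hat\pi,\rho)$; 5. stop and return $m_t$ if, for every $p$, the arm $m_t(p)$ and all arms ranked above it in $\hat\pi_p$ have been removed from $S_p$; otherwise go on to round $t+1$. **Elimination times and phases.** Let $t_{p,a}$ be the least integer $t\ge1$ with $4\epsilon_t<|\mu_{p,a}-\mu_{p,a'}|$ for all $a'\ne a$. If $K\ge2$ let $\Delta_{p,a}=\min_{a'\neq a}|\mu_{p,a}-\mu_{p,a'}|$. For a set $E$ of pairs let $\Delta(E)$ be the maximal degree of the bipartite graph with edge set $E$, and let $\mathcal P(E)=\{r\subseteq E:\Delta(E)-\Delta(E\setminus r)=1\}$. Let $S$ be the set of all player-arm pairs and $r_0=\emptyset$, and for $i=1,\dots,K$ let $$r_i\in\arg\min_{r\in\mathcal P(S\setminus\bigcup_{j<i}r_j)}\ \max_{(p,a)\in r}t_{p,a},$$ where ties between minimizers are resolved so that $\max_{(p,a)\in r_i}t_{p,a}$ is nondecreasing in $i$. **Theorem.**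 There is a universal constant $C>0$ such that the following holds in every such setting. (i) There is exactly one player-optimal stable matching $m_s^\star$ for $(\pi,\rho)$, i.e. one stable matching in which every player does at least as well as in every stable matching. (ii) If $K\ge 2$, then $t_{p,a}\le C\,\dfrac{\ln\left(KN/(\delta\Delta_{p,a})\right)}{\Delta_{p,a}^2}$ for all $p,a$. (iii) The algorithm is $\delta$-PCOS (probably correct optimal stable): with probability at least $1-\delta$ it stops and returns $m_s^\star$. (iv) Let $t_{\max}=\max\{t_{p,a}: p \text{ weakly prefers } a \text{ to } m_s^\star(p)\}$, and let $n\in\{1,\dots,K\}$ satisfy $\max_{(p,a)\in r_{n-1}}t_{p,a}\le t_{\max}\le\max_{(p,a)\in r_n}t_{p,a}$ (a maximum over $\emptyset$ is $0$). Such $r_1,\dots,r_K$ and $n$ exist, and for every choice of them, with probability at least $1-\delta$, the algorithm stops and returns $m_s^\star$ after at most $$C\left(\sum_{s=1}^{n-1}\max_{(p,a)\in r_s}t_{p,a}+(K-n+1)\,t_{\max}\right)$$ sampled matchings. -/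

import Mathlib

open MeasureTheory ProbabilityTheory

/-! ### Preferences, matchings, stability

Players are `Fin N`, arms are `Fin K`.  A preference list over `n` agents is a permutation
`σ : Equiv.Perm (Fin n)`: `σ i` is the agent at position `i`, position `0` being the best. -/

/-- `x` is strictly preferred to `y` in the list `σ`. -/
def StrictlyPrefers {n : ℕ} (σ : Equiv.Perm (Fin n)) (x y : Fin n) : Prop :=
  σ.symm x < σ.symm y

/-- `x` is weakly preferred to `y` in the list `σ`. -/
def WeaklyPrefers {n : ℕ} (σ : Equiv.Perm (Fin n)) (x y : Fin n) : Prop :=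
  σ.symm x ≤ σ.symm y

instance {n : ℕ} (σ : Equiv.Perm (Fin n)) (x y : Fin n) : Decidable (StrictlyPrefers σ x y) :=
  inferInstanceAs (Decidable (σ.symm x < σ.symm y))

instance {n : ℕ} (σ : Equiv.Perm (Fin n)) (x y : Fin n) : Decidable (WeaklyPrefers σ x y) :=
  inferInstanceAs (Decidable (σ.symm x ≤ σ.symm y))

/-- A matching is a set of pairwise disjoint player-arm pairs. -/
def IsMatching {N K : ℕ} (m : Finset (Fin N × Fin K)) : Prop :=
  ∀ e ∈ m, ∀ f ∈ m, e ≠ f → e.1 ≠ f.1 ∧ e.2 ≠ f.2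

/-- `(p, a)` blocks `m`: it is not in `m`, the player `p` is unmatched or prefers `a` to its
partner, and the arm `a` is unmatched or prefers `p` to its partner. -/
def IsBlockingPair {N K : ℕ} (π : Fin N → Equiv.Perm (Fin K)) (ρ : Fin K → Equiv.Perm (Fin N))
    (m : Finset (Fin N × Fin K)) (p : Fin N) (a : Fin K) : Prop :=
  (p, a) ∉ m ∧ (∀ b, (p, b) ∈ m → StrictlyPrefers (π p) a b) ∧
    (∀ q, (q, a) ∈ m → StrictlyPrefers (ρ a) p q)

/-- Stable matchings. -/
def IsStableMatching {N K : ℕ} (π : Fin N → Equiv.Perm (Fin K)) (ρ : Fin K → Equiv.Perm (Fin N))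
    (m : Finset (Fin N × Fin K)) : Prop :=
  IsMatching m ∧ ∀ p a, ¬ IsBlockingPair π ρ m p a

/-- `m` is stable, and every player is matched in `m` at least as well as in any stable
matching. -/
def IsPlayerOptimalStable {N K : ℕ} (π : Fin N → Equiv.Perm (Fin K))
    (ρ : Fin K → Equiv.Perm (Fin N)) (m : Finset (Fin N × Fin K)) : Prop :=
  IsStableMatching π ρ m ∧ ∀ m', IsStableMatching π ρ m' →
    ∀ p a', (p, a') ∈ m' → ∃ a, (p, a) ∈ m ∧ WeaklyPrefers (π p) a a'

/-! ### Deferred acceptance (players propose) -/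

/-- The arm to which `p` currently proposes, when it has been rejected `c p` times so far. -/
def proposal {N K : ℕ} (π : Fin N → Equiv.Perm (Fin K)) (c : Fin N → ℕ) (p : Fin N) :
    Option (Fin K) :=
  if h : c p < K then some (π p ⟨c p, h⟩) else none

/-- One step: every arm keeps the best of its current proposers and rejects the others, and a
rejected player moves on to the next arm of its list.  (A temporarily matched player goes on
proposing to the same arm.) -/
def daStep {N K : ℕ} (π : Fin N → Equiv.Perm (Fin K)) (ρ : Fin K → Equiv.Perm (Fin N))
    (c : Fin N → ℕ) (p : Fin N) : ℕ :=
  if ∃ a : Fin K, ∃ q : Fin N, proposal π c p = some a ∧ proposal π c q = some a ∧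
      StrictlyPrefers (ρ a) q p
  then c p + 1 else c p

/-- The matching output by deferred acceptance.  Every step before the process becomes stationary
has at least one rejection and there are at most `N * K` rejections, so `N * K` steps reach the
end of the process. -/
def deferredAcceptance {N K : ℕ} (π : Fin N → Equiv.Perm (Fin K))
    (ρ : Fin K → Equiv.Perm (Fin N)) : Finset (Fin N × Fin K) :=
  Finset.univ.filter fun e => proposal π ((daStep π ρ)^[N * K] (fun _ => 0)) e.1 = some e.2

/-! ### Minimal matching covers and degrees -/

/-- `M` is a set of matchings that contains each pair of `E` in exactly one of its members (and no
other pair), with the least number of members among all sets of matchings that cover `E`. -/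
def IsMinimalMatchingCover {N K : ℕ} (E : Finset (Fin N × Fin K))
    (M : Finset (Finset (Fin N × Fin K))) : Prop :=
  (∀ m ∈ M, IsMatching m ∧ m ⊆ E) ∧ (∀ e ∈ E, ∃! m, m ∈ M ∧ e ∈ m) ∧
    ∀ M' : Finset (Finset (Fin N × Fin K)), (∀ m ∈ M', IsMatching m) →
      (∀ e ∈ E, ∃ m ∈ M', e ∈ m) → M.card ≤ M'.card

/-- The maximal degree of the bipartite graph with edge set `E`. -/
def maxDegree {N K : ℕ} (E : Finset (Fin N × Fin K)) : ℕ :=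
  max (Finset.univ.sup fun p : Fin N => (E.filter fun e => e.1 = p).card)
    (Finset.univ.sup fun a : Fin K => (E.filter fun e => e.2 = a).card)

/-! ### Rewards -/

/-- The mean reward of `p` from `a`, for reward distributions `ν`. -/
noncomputable def meanReward {N K : ℕ} (ν : Fin N → Fin K → Measure ℝ) (p : Fin N) (a : Fin K) :
    ℝ :=
  ∫ x, x ∂(ν p a)

/-- `X p a i` is the reward that `p` receives from `a` when the pair is sampled for the `(i+1)`-st
time.  For each pair, these are independent with law `ν p a`, a law on `[0, 1]`. -/
structure IsRewardModel {N K : ℕ} {Ω : Type*} [MeasurableSpace Ω] (P : Measure Ω)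
    (ν : Fin N → Fin K → Measure ℝ) (X : Fin N → Fin K → ℕ → Ω → ℝ) : Prop where
  measurable : ∀ p a i, Measurable (X p a i)
  law : ∀ p a i, P.map (X p a i) = ν p a
  indep : ∀ p a, iIndepFun (X p a) P
  range : ∀ p a, ∀ᵐ x ∂(ν p a), x ∈ Set.Icc (0 : ℝ) 1

/-! ### The Improved Elimination Algorithm -/

/-- `srt v` lists the indices by decreasing value of `v`; ties may be broken in any way. -/
def IsArgsort {K : ℕ} (srt : (Fin K → ℝ) → Equiv.Perm (Fin K)) : Prop :=
  ∀ v : Fin K → ℝ, Antitone fun i => v (srt v i)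

/-- The confidence radius of round `t`. -/
noncomputable def confRadius (N K : ℕ) (δ : ℝ) (t : ℕ) : ℝ :=
  Real.sqrt (Real.log (4 * K * N * (t : ℝ) ^ 2 / δ) / (2 * t))

/-- The state of the algorithm between two rounds. -/
structure AlgState (N K : ℕ) where
  /-- the available pairs: `(p, a) ∈ active` means `a ∈ S_p` -/
  active : Finset (Fin N × Fin K)
  /-- the sample means -/
  est : Fin N → Fin K → ℝ
  /-- the current estimate of the optimal stable matching -/
  matching : Finset (Fin N × Fin K)
  /-- the pairs on which the loop condition depends: the loop goes on while this is nonempty -/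
  pending : Finset (Fin N × Fin K)
  /-- the number of matchings sampled so far -/
  cost : ℕ

/-- The state before round `1`. -/
def initState (N K : ℕ) : AlgState N K where
  active := Finset.univ
  est := fun _ _ => 0
  matching := ∅
  pending := Finset.univ
  cost := 0

open Classical in
/-- The sample means after round `t`, the pairs in `active` being available in that round.  An
available pair has been sampled once in each of the rounds `1, …, t`; the sample mean of any other
pair is not updated. -/
noncomputable def updateEst {N K : ℕ} (x : Fin N → Fin K → ℕ → ℝ) (t : ℕ)
    (active : Finset (Fin N × Fin K)) (est : Fin N → Fin K → ℝ) (p : Fin N) (a : Fin K) : ℝ :=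
  if (p, a) ∈ active then (∑ i ∈ Finset.range t, x p a i) / t else est p a

/-- The confidence interval around the estimate of `(p, a)`, in round `t`. -/
noncomputable def confInterval {N K : ℕ} (δ : ℝ) (t : ℕ) (est : Fin N → Fin K → ℝ) (p : Fin N)
    (a : Fin K) : Set ℝ :=
  Set.Icc (est p a - confRadius N K δ t) (est p a + confRadius N K δ t)

open Classical in
/-- The pairs that are still available after a round: `(p, a)` is eliminated when the confidence
interval of `a` meets that of no other available arm of `p`. -/
noncomputable def eliminate {N K : ℕ} (δ : ℝ) (t : ℕ) (active : Finset (Fin N × Fin K))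
    (est : Fin N → Fin K → ℝ) : Finset (Fin N × Fin K) :=
  active.filter fun e => ¬ ∀ j, j ≠ e.2 → (e.1, j) ∈ active →
    confInterval δ t est e.1 e.2 ∩ confInterval δ t est e.1 j = ∅

/-- The pairs `(p, a)` of `E` for which `p`, with preferences `π p`, weakly prefers `a` to its
partner in `m` (every arm is preferred to being unmatched). -/
def upToPartner {N K : ℕ} (π : Fin N → Equiv.Perm (Fin K)) (m E : Finset (Fin N × Fin K)) :
    Finset (Fin N × Fin K) :=
  E.filter fun e => ∀ b, (e.1, b) ∈ m → WeaklyPrefers (π e.1) e.2 b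

/-- Round `t`.  `x p a i` is the reward of the `(i+1)`-st sample of `(p, a)`, `ρ` are the
preferences of the arms, `srt` the sorting routine, and `cover` the routine for minimal matching
covers; all the matchings of the cover of the available pairs are sampled. -/
noncomputable def algRound {N K : ℕ} (δ : ℝ) (ρ : Fin K → Equiv.Perm (Fin N))
    (srt : (Fin K → ℝ) → Equiv.Perm (Fin K))
    (cover : Finset (Fin N × Fin K) → Finset (Finset (Fin N × Fin K)))
    (x : Fin N → Fin K → ℕ → ℝ) (t : ℕ) (s : AlgState N K) : AlgState N K :=
  let est' := updateEst x t s.active s.est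
  let active' := eliminate δ t s.active est'
  let π' : Fin N → Equiv.Perm (Fin K) := fun p => srt (est' p)
  let m' := deferredAcceptance π' ρ
  { active := active'
    est := est'
    matching := m'
    pending := upToPartner π' m' active'
    cost := s.cost + (cover s.active).card }

/-- The state after `t` rounds, when the loop condition is ignored. -/
noncomputable def algState {N K : ℕ} (δ : ℝ) (ρ : Fin K → Equiv.Perm (Fin N))
    (srt : (Fin K → ℝ) → Equiv.Perm (Fin K))
    (cover : Finset (Fin N × Fin K) → Finset (Finset (Fin N × Fin K)))
    (x : Fin N → Fin K → ℕ → ℝ) : ℕ → AlgState N K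
  | 0 => initState N K
  | t + 1 => algRound δ ρ srt cover x (t + 1) (algState δ ρ srt cover x t)

/-- On the rewards `x`, the algorithm stops (the first time that the loop condition fails) and
returns `m`, having sampled `c` matchings. -/
def Returns {N K : ℕ} (δ : ℝ) (ρ : Fin K → Equiv.Perm (Fin N))
    (srt : (Fin K → ℝ) → Equiv.Perm (Fin K))
    (cover : Finset (Fin N × Fin K) → Finset (Finset (Fin N × Fin K)))
    (x : Fin N → Fin K → ℕ → ℝ) (m : Finset (Fin N × Fin K)) (c : ℕ) : Prop :=
  ∃ T : ℕ, (algState δ ρ srt cover x T).pending = ∅ ∧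
    (∀ t < T, (algState δ ρ srt cover x t).pending.Nonempty) ∧
    (algState δ ρ srt cover x T).matching = m ∧ (algState δ ρ srt cover x T).cost = c

/-! ### The quantities in the sample complexity -/

/-- The gap of `(p, a)`: the least difference between the mean of `a` and that of another arm. -/
noncomputable def gap {N K : ℕ} (μ : Fin N → Fin K → ℝ) (p : Fin N) (a : Fin K) : ℝ :=
  ⨅ j : {j : Fin K // j ≠ a}, |μ p a - μ p j|

/-- The elimination time of `(p, a)`: the least number `t` of samples for which the mean of `a`
differs from that of every other arm by more than four confidence radii. -/
noncomputable def elimTime {N K : ℕ} (δ : ℝ) (μ : Fin N → Fin K → ℝ) (e : Fin N × Fin K) : ℕ :=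
  sInf {t : ℕ | 1 ≤ t ∧ ∀ j, j ≠ e.2 → 4 * confRadius N K δ t < |μ e.1 e.2 - μ e.1 j|}

/-- `r` is a set of pairs of `E` whose removal lowers the maximal degree by exactly one. -/
def DegreeReducing {N K : ℕ} (E r : Finset (Fin N × Fin K)) : Prop :=
  r ⊆ E ∧ maxDegree E = maxDegree (E \ r) + 1

/-- The pairs outside `r 0, …, r (i - 1)`. -/
def remaining {N K : ℕ} (r : ℕ → Finset (Fin N × Fin K)) (i : ℕ) : Finset (Fin N × Fin K) :=
  Finset.univ \ (Finset.range i).biUnion r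

/-- `r 1, …, r K` are the sets of pairs eliminated in the phases `1, …, K`, for the elimination
times `τ`: each `r i` is a set, with the least maximal elimination time, among those whose removal
from the remaining pairs lowers the maximal degree by one; the phases are in chronological
order. -/
structure IsPhaseSequence {N K : ℕ} (τ : Fin N × Fin K → ℕ) (r : ℕ → Finset (Fin N × Fin K)) :
    Prop where
  zero : r 0 = ∅
  reducing : ∀ i, 1 ≤ i → i ≤ K → DegreeReducing (remaining r i) (r i)
  minimal : ∀ i, 1 ≤ i → i ≤ K → ∀ r', DegreeReducing (remaining r i) r' →
    (r i).sup τ ≤ r'.sup τ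
  chronological : ∀ i, 1 ≤ i → i < K → (r i).sup τ ≤ (r (i + 1)).sup τ

/-- `n ∈ {1, …, K}` is an index of a phase within which the time `tmax` falls. -/
def IsPhaseIndex {N K : ℕ} (τ : Fin N × Fin K → ℕ) (r : ℕ → Finset (Fin N × Fin K)) (tmax : ℕ)
    (n : ℕ) : Prop :=
  1 ≤ n ∧ n ≤ K ∧ (r (n - 1)).sup τ ≤ tmax ∧ tmax ≤ (r n).sup τ

/-- The largest elimination time of a pair `(p, a)` such that `p` weakly prefers `a` to its partner
in `m`. -/
def maxElimTime {N K : ℕ} (τ : Fin N × Fin K → ℕ) (π : Fin N → Equiv.Perm (Fin K))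
    (m : Finset (Fin N × Fin K)) : ℕ :=
  (upToPartner π m Finset.univ).sup τ

/-! All randomness is confined to one event: for every pair and every t ≥ 1, the mean of the first t
rewards lies within ε_t of the true mean (`AccurateRewards`). Hoeffding and a union bound give
failure probability at most Σ_t KN · δ/(2KNt²) = (δ/2)·π²/6 ≤ δ. Everything else is deterministic on
this event.

Correctness: when an arm is removed, its sample mean is on the correct side of every other available
one, and this survives later updates because ε_t decreases (`est_separated`). So a removed arm has
the same position in the estimated and the true list. Deferred acceptance reads a list only up to
its last proposal (`daFinal_congr`). The stopping rule says that all the arms it reads have been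
removed, so its output is the one for the true lists, which is player-optimal.

Cost: every pair is removed by its elimination time, so the algorithm stops by t_max. Greedy
colouring covers a graph of maximal degree D by 2D matchings. Pairs available after t rounds avoid
every phase whose largest elimination time is at most t, so their degree is at most K minus the
number of such phases (`IsPhaseSequence.maxDegree_add_card_le`). Summing over t and exchanging the
sums yields the bound. -/

/-! ### Deferred acceptance -/

section DeferredAcceptance

variable {N K : ℕ} {π π' : Fin N → Equiv.Perm (Fin K)} {ρ : Fin K → Equiv.Perm (Fin N)}

/-- `p` is rejected in the step from `c`. -/
def IsRejected (π : Fin N → Equiv.Perm (Fin K)) (ρ : Fin K → Equiv.Perm (Fin N))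
    (c : Fin N → ℕ) (p : Fin N) : Prop :=
  ∃ a : Fin K, ∃ q : Fin N, proposal π c p = some a ∧ proposal π c q = some a ∧
    StrictlyPrefers (ρ a) q p

/-- The numbers of rejections after `j` steps. -/
def daCount (π : Fin N → Equiv.Perm (Fin K)) (ρ : Fin K → Equiv.Perm (Fin N)) (j : ℕ) :
    Fin N → ℕ :=
  (daStep π ρ)^[j] (fun _ => 0)

/-- The numbers of rejections at the end. -/
def daFinal (π : Fin N → Equiv.Perm (Fin K)) (ρ : Fin K → Equiv.Perm (Fin N)) : Fin N → ℕ :=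
  daCount π ρ (N * K)

theorem daStep_of_isRejected {c : Fin N → ℕ} {p : Fin N} (h : IsRejected π ρ c p) :
    daStep π ρ c p = c p + 1 := if_pos h

theorem daStep_of_not_isRejected {c : Fin N → ℕ} {p : Fin N} (h : ¬ IsRejected π ρ c p) :
    daStep π ρ c p = c p := if_neg h

theorem proposal_eq_some {c : Fin N → ℕ} {p : Fin N} {a : Fin K} :
    proposal π c p = some a ↔ c p = (π p).symm a := by
  unfold proposal
  split_ifs with h
  · rw [Option.some.injEq]
    constructor
    · rintro rfl; simp
    · intro h'
      rw [← Equiv.eq_symm_apply]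
      exact Fin.ext h'
  · constructor
    · intro h'; cases h'
    · intro h'; exact absurd (h' ▸ ((π p).symm a).2) h

theorem le_daStep (c : Fin N → ℕ) (p : Fin N) : c p ≤ daStep π ρ c p := by
  by_cases h : IsRejected π ρ c p
  · rw [daStep_of_isRejected h]; omega
  · rw [daStep_of_not_isRejected h]

theorem daStep_le {c : Fin N → ℕ} (hc : ∀ p, c p ≤ K) (p : Fin N) : daStep π ρ c p ≤ K := by
  by_cases h : IsRejected π ρ c p
  · rw [daStep_of_isRejected h]
    obtain ⟨a, q, h1, -⟩ := h
    have := proposal_eq_some.1 h1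
    have := ((π p).symm a).2
    omega
  · rw [daStep_of_not_isRejected h]; exact hc p

theorem daCount_zero (p : Fin N) : daCount π ρ 0 p = 0 := rfl

theorem daCount_succ (j : ℕ) : daCount π ρ (j + 1) = daStep π ρ (daCount π ρ j) :=
  Function.iterate_succ_apply' _ _ _

theorem daCount_le (j : ℕ) (p : Fin N) : daCount π ρ j p ≤ K := by
  induction j generalizing p with
  | zero => exact Nat.zero_le _
  | succ j ih => rw [daCount_succ]; exact daStep_le ih p

theorem daCount_mono : Monotone (daCount π ρ) :=
  monotone_nat_of_le_succ fun j p => by rw [daCount_succ]; exact le_daStep _ p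

/-- A fixed point reached earlier would persist, so if the last state were not fixed, each of the
first N * K + 1 steps would add a rejection. But no player is rejected more than K times. -/
theorem daStep_daFinal : daStep π ρ (daFinal π ρ) = daFinal π ρ := by
  by_contra hne
  have key : ∀ j, j ≤ N * K + 1 → j ≤ ∑ p, daCount π ρ j p := by
    intro j
    induction j with
    | zero => intro _; exact Nat.zero_le _
    | succ j ih =>
      intro hj
      have h1 := ih (by omega)
      have h2 : ∑ p, daCount π ρ j p < ∑ p, daCount π ρ (j + 1) p := by
        have hfix : daStep π ρ (daCount π ρ j) ≠ daCount π ρ j := by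
          intro hfix
          apply hne
          have : daFinal π ρ = daCount π ρ j := by
            unfold daFinal
            obtain ⟨k, hk⟩ := Nat.exists_eq_add_of_le (show j ≤ N * K by omega)
            rw [hk]
            unfold daCount at hfix ⊢
            rw [add_comm j k, Function.iterate_add_apply]
            exact Function.iterate_fixed hfix k
          rw [this, hfix]
        obtain ⟨p, hp⟩ := Function.ne_iff.1 hfix
        rw [daCount_succ]
        exact Finset.sum_lt_sum (fun q _ => le_daStep _ q)
          ⟨p, Finset.mem_univ _, lt_of_le_of_ne (le_daStep _ p) (Ne.symm hp)⟩
      omega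
  have h1 := key (N * K + 1) le_rfl
  have h2 : ∑ p : Fin N, daCount π ρ (N * K + 1) p ≤ ∑ _p : Fin N, K :=
    Finset.sum_le_sum fun p _ => daCount_le _ p
  simp only [Finset.sum_const, Finset.card_univ, Fintype.card_fin, smul_eq_mul] at h2
  omega

theorem not_isRejected_daFinal (p : Fin N) : ¬ IsRejected π ρ (daFinal π ρ) p := by
  intro h
  have h1 := daStep_of_isRejected h
  rw [daStep_daFinal] at h1
  omega

theorem mem_deferredAcceptance {p : Fin N} {a : Fin K} :
    (p, a) ∈ deferredAcceptance π ρ ↔ daFinal π ρ p = (π p).symm a := by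
  unfold deferredAcceptance
  rw [Finset.mem_filter]
  simp only [Finset.mem_univ, true_and]
  exact proposal_eq_some

/-- Arms only trade up: the best current proposer of `a` is not rejected, so once `a` has rejected
`p` it always holds someone better. -/
theorem exists_better_proposer_of_lt_daCount (j : ℕ) (p : Fin N) (a : Fin K)
    (h : ((π p).symm a : ℕ) < daCount π ρ j p) :
    ∃ q, daCount π ρ j q = (π q).symm a ∧ StrictlyPrefers (ρ a) q p := by
  induction j generalizing p with
  | zero => rw [daCount_zero] at h; omega
  | succ j ih =>
    -- some current proposer is better than `p`, hence so is the best one, which is kept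
    have h1 : ∃ q, daCount π ρ j q = (π q).symm a ∧ StrictlyPrefers (ρ a) q p := by
      by_cases hlt : ((π p).symm a : ℕ) < daCount π ρ j p
      · exact ih p hlt
      · rw [daCount_succ] at h
        by_cases hr : IsRejected π ρ (daCount π ρ j) p
        · rw [daStep_of_isRejected hr] at h
          obtain ⟨b, q, hb, hq, hqp⟩ := hr
          rw [proposal_eq_some] at hb hq
          have hab : a = b := by
            apply (π p).symm.injective
            apply Fin.ext
            omega
          subst hab
          exact ⟨q, hq, hqp⟩
        · rw [daStep_of_not_isRejected hr] at h; omega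
    obtain ⟨q, hq, hqp⟩ := h1
    obtain ⟨q₀, hq₀, hmin⟩ := Finset.exists_min_image
      (Finset.univ.filter fun q => daCount π ρ j q = (π q).symm a) (fun q => (ρ a).symm q)
      ⟨q, by simpa using hq⟩
    simp only [Finset.mem_filter, Finset.mem_univ, true_and] at hq₀ hmin
    refine ⟨q₀, ?_, lt_of_le_of_lt (hmin q hq) hqp⟩
    rw [daCount_succ, daStep_of_not_isRejected, hq₀]
    rintro ⟨b, q', hb, hq', hlt⟩
    rw [proposal_eq_some] at hb hq'
    have hab : a = b := (π q₀).symm.injective (Fin.ext (hq₀.symm.trans hb))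
    subst hab
    exact absurd hlt (not_lt.2 (hmin q' hq'))

theorem deferredAcceptance_isStableMatching : IsStableMatching π ρ (deferredAcceptance π ρ) := by
  constructor
  · rintro ⟨p, a⟩ he ⟨q, b⟩ hf hne
    rw [mem_deferredAcceptance] at he hf
    constructor
    · rintro (rfl : p = q)
      exact hne (by rw [(π p).symm.injective (Fin.ext (he.symm.trans hf))])
    · rintro (rfl : a = b)
      have hpq : p ≠ q := fun h => hne (by rw [h])
      rcases lt_or_gt_of_ne (fun h => hpq ((ρ a).symm.injective h)) with h | h
      · exact not_isRejected_daFinal q ⟨a, p, proposal_eq_some.2 hf, proposal_eq_some.2 he, h⟩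
      · exact not_isRejected_daFinal p ⟨a, q, proposal_eq_some.2 he, proposal_eq_some.2 hf, h⟩
  · rintro p a ⟨hnot, hp, ha⟩
    rw [mem_deferredAcceptance] at hnot
    have hlt : ((π p).symm a : ℕ) < daFinal π ρ p := by
      by_cases hK : daFinal π ρ p < K
      · have := hp (π p ⟨_, hK⟩) (mem_deferredAcceptance.2 (by simp))
        unfold StrictlyPrefers at this
        rw [Equiv.symm_apply_apply] at this
        exact this
      -- An unmatched player has exhausted its list, so it has been rejected by `a` too.
      · have := ((π p).symm a).2
        omega
    obtain ⟨q, hq, hqp⟩ := exists_better_proposer_of_lt_daCount _ p a hlt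
    exact lt_asymm hqp (ha q (mem_deferredAcceptance.2 hq))

/-- No player is ever rejected by a stable partner. If `q` displaced `p` from its partner `a` in
`m`, then by induction `q` has not yet moved past its own partner in `m`, hence prefers `a` to it,
and `(q, a)` blocks `m`. -/
theorem daCount_le_of_mem_stable {m : Finset (Fin N × Fin K)} (hm : IsStableMatching π ρ m)
    (j : ℕ) {p : Fin N} {a : Fin K} (h : (p, a) ∈ m) : daCount π ρ j p ≤ (π p).symm a := by
  induction j generalizing p a with
  | zero => exact Nat.zero_le _
  | succ j ih =>
    rw [daCount_succ]
    by_cases hr : IsRejected π ρ (daCount π ρ j) p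
    · rw [daStep_of_isRejected hr, Nat.succ_le_iff]
      refine lt_of_le_of_ne (ih h) fun heq => ?_
      obtain ⟨b, q, hb, hq, hqp⟩ := hr
      rw [proposal_eq_some] at hb hq
      have hab : a = b := (π p).symm.injective (Fin.ext (heq.symm.trans hb))
      subst hab
      have hqa : (q, a) ∉ m := fun hqa => by
        have hne : q ≠ p := fun h' => by subst h'; exact lt_irrefl _ hqp
        exact (hm.1 _ hqa _ h (fun h' => hne (congrArg Prod.fst h'))).2 rfl
      refine hm.2 q a ⟨hqa, fun b hb => ?_, fun q' hq' => ?_⟩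
      · have h1 := ih hb
        rw [hq] at h1
        refine lt_of_le_of_ne h1 fun h2 => hqa ?_
        rwa [(π q).symm.injective h2]
      · have : q' = p := by
          by_contra hne
          exact (hm.1 _ hq' _ h (fun h' => hne (congrArg Prod.fst h'))).2 rfl
        rwa [this]
    · rw [daStep_of_not_isRejected hr]; exact ih h

theorem deferredAcceptance_isPlayerOptimalStable :
    IsPlayerOptimalStable π ρ (deferredAcceptance π ρ) := by
  refine ⟨deferredAcceptance_isStableMatching, fun m hm p a ha => ?_⟩
  have h := daCount_le_of_mem_stable hm (N * K) ha
  have hK : daFinal π ρ p < K := lt_of_le_of_lt h ((π p).symm a).2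
  refine ⟨π p ⟨_, hK⟩, mem_deferredAcceptance.2 (by simp), ?_⟩
  unfold WeaklyPrefers
  rw [Equiv.symm_apply_apply]
  exact h

theorem IsPlayerOptimalStable.subset {m m' : Finset (Fin N × Fin K)}
    (h : IsPlayerOptimalStable π ρ m) (h' : IsPlayerOptimalStable π ρ m') : m ⊆ m' := by
  rintro ⟨p, a⟩ ha
  obtain ⟨b, hb, hba⟩ := h'.2 m h.1 p a ha
  obtain ⟨a', ha', hab⟩ := h.2 m' h'.1 p b hb
  have haa : a' = a := by
    by_contra hne
    exact (h.1.1 _ ha' _ ha (fun h' => hne (congrArg Prod.snd h'))).1 rfl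
  subst haa
  rwa [(π p).symm.injective (le_antisymm hab hba)]

theorem isPlayerOptimalStable_iff {m : Finset (Fin N × Fin K)} :
    IsPlayerOptimalStable π ρ m ↔ m = deferredAcceptance π ρ := by
  constructor
  · intro h
    exact (h.subset deferredAcceptance_isPlayerOptimalStable).antisymm
      (deferredAcceptance_isPlayerOptimalStable.subset h)
  · rintro rfl; exact deferredAcceptance_isPlayerOptimalStable

/-- Deferred acceptance reads the preference list of a player only up to its last proposal. -/
theorem daFinal_congr
    (h : ∀ p (i : Fin K), (i : ℕ) ≤ daFinal π ρ p → π p i = π' p i) :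
    daFinal π' ρ = daFinal π ρ := by
  have hprop : ∀ j, j ≤ N * K → ∀ p,
      proposal π (daCount π ρ j) p = proposal π' (daCount π ρ j) p := by
    intro j hj p
    unfold proposal
    split_ifs with hK
    · rw [h p ⟨_, hK⟩ (daCount_mono hj p)]
    · rfl
  have key : ∀ j, j ≤ N * K → daCount π' ρ j = daCount π ρ j := by
    intro j
    induction j with
    | zero => intro _; rfl
    | succ j ih =>
      intro hj
      rw [daCount_succ, daCount_succ, ih (by omega)]
      funext p
      unfold daStep
      simp only [hprop j (by omega)]
  exact key _ le_rfl

theorem deferredAcceptance_congr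
    (h : ∀ p (i : Fin K), (i : ℕ) ≤ daFinal π ρ p → π p i = π' p i) :
    deferredAcceptance π' ρ = deferredAcceptance π ρ := by
  ext ⟨p, a⟩
  rw [mem_deferredAcceptance, mem_deferredAcceptance, daFinal_congr h]
  constructor
  · intro h'
    have h1 := h p ((π' p).symm a) h'.ge
    rw [Equiv.apply_symm_apply, ← Equiv.eq_symm_apply] at h1
    rw [h', h1]
  · intro h'
    have h1 := h p ((π p).symm a) h'.ge
    rw [Equiv.apply_symm_apply, eq_comm, ← Equiv.eq_symm_apply] at h1
    rw [h', h1]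

/-- Turns the loop condition into a bound on positions, the form in which `daFinal_congr` uses it;
it also covers unmatched players, for whom both sides allow the whole list. -/
theorem mem_upToPartner_deferredAcceptance {E : Finset (Fin N × Fin K)} {p : Fin N} {a : Fin K} :
    (p, a) ∈ upToPartner π (deferredAcceptance π ρ) E ↔
      (p, a) ∈ E ∧ ((π p).symm a : ℕ) ≤ daFinal π ρ p := by
  unfold upToPartner
  rw [Finset.mem_filter]
  refine and_congr_right fun _ => ⟨fun h => ?_, fun h b hb => ?_⟩
  · by_cases hK : daFinal π ρ p < K
    · have := h (π p ⟨_, hK⟩) (mem_deferredAcceptance.2 (by simp))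
      unfold WeaklyPrefers at this
      rw [Equiv.symm_apply_apply] at this
      exact this
    · have := ((π p).symm a).2
      omega
  · rw [mem_deferredAcceptance] at hb
    rw [hb] at h
    exact h

end DeferredAcceptance

/-! ### Degrees, edge colourings and phases -/

section Degrees

variable {N K : ℕ} {E F : Finset (Fin N × Fin K)} {τ : Fin N × Fin K → ℕ}
  {r : ℕ → Finset (Fin N × Fin K)}

theorem maxDegree_le_iff {D : ℕ} : maxDegree E ≤ D ↔
    (∀ p, (E.filter fun e => e.1 = p).card ≤ D) ∧ ∀ a, (E.filter fun e => e.2 = a).card ≤ D := by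
  unfold maxDegree
  rw [max_le_iff, Finset.sup_le_iff, Finset.sup_le_iff]
  simp

theorem maxDegree_mono (h : E ⊆ F) : maxDegree E ≤ maxDegree F := by
  obtain ⟨h1, h2⟩ := maxDegree_le_iff.1 (le_refl (maxDegree F))
  exact maxDegree_le_iff.2
    ⟨fun p => (Finset.card_le_card (Finset.filter_subset_filter _ h)).trans (h1 p),
      fun a => (Finset.card_le_card (Finset.filter_subset_filter _ h)).trans (h2 a)⟩

theorem maxDegree_le_erase_add_one (e : Fin N × Fin K) :
    maxDegree E ≤ maxDegree (E.erase e) + 1 := by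
  obtain ⟨h1, h2⟩ := maxDegree_le_iff.1 (le_refl (maxDegree (E.erase e)))
  refine maxDegree_le_iff.2 ⟨fun p => ?_, fun a => ?_⟩
  · have h := h1 p
    rw [Finset.filter_erase] at h
    have := Finset.pred_card_le_card_erase (s := E.filter fun e => e.1 = p) (a := e)
    omega
  · have h := h2 a
    rw [Finset.filter_erase] at h
    have := Finset.pred_card_le_card_erase (s := E.filter fun e => e.2 = a) (a := e)
    omega

theorem maxDegree_empty : maxDegree (∅ : Finset (Fin N × Fin K)) = 0 := by
  rw [← Nat.le_zero, maxDegree_le_iff]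
  simp

theorem eq_empty_of_maxDegree_eq_zero (h : maxDegree E = 0) : E = ∅ := by
  rw [Finset.eq_empty_iff_forall_notMem]
  intro e he
  have h1 := (maxDegree_le_iff.1 h.le).1 e.1
  have h2 : 0 < (E.filter fun f => f.1 = e.1).card :=
    Finset.card_pos.2 ⟨e, Finset.mem_filter.2 ⟨he, rfl⟩⟩
  omega

theorem maxDegree_univ (hN : 1 ≤ N) (hNK : N ≤ K) :
    maxDegree (Finset.univ : Finset (Fin N × Fin K)) = K := by
  have h1 : ∀ p : Fin N, ((Finset.univ : Finset (Fin N × Fin K)).filter fun e => e.1 = p).card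
      = K := by
    intro p
    rw [show ((Finset.univ : Finset (Fin N × Fin K)).filter fun e => e.1 = p) =
      ({p} : Finset (Fin N)) ×ˢ (Finset.univ : Finset (Fin K)) by ext ⟨q, b⟩; simp [eq_comm]]
    simp
  have h2 : ∀ a : Fin K, ((Finset.univ : Finset (Fin N × Fin K)).filter fun e => e.2 = a).card
      = N := by
    intro a
    rw [show ((Finset.univ : Finset (Fin N × Fin K)).filter fun e => e.2 = a) =
      (Finset.univ : Finset (Fin N)) ×ˢ ({a} : Finset (Fin K)) by ext ⟨q, b⟩; simp [eq_comm]]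
    simp
  apply le_antisymm
  · exact maxDegree_le_iff.2 ⟨fun p => (h1 p).le, fun a => (h2 a).le.trans hNK⟩
  · exact (h1 ⟨0, hN⟩).ge.trans ((maxDegree_le_iff.1 le_rfl).1 _)

/-- Greedy edge colouring. -/
theorem exists_edge_colouring {D : ℕ} (h : maxDegree E ≤ D) :
    ∃ f : Fin N × Fin K → ℕ, (∀ e ∈ E, f e < 2 * D) ∧
      ∀ e ∈ E, ∀ e' ∈ E, e ≠ e' → f e = f e' → e.1 ≠ e'.1 ∧ e.2 ≠ e'.2 := by
  classical
  induction E using Finset.induction_on with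
  | empty => exact ⟨fun _ => 0, by simp, by simp⟩
  | insert e E he ih =>
    obtain ⟨f, hf, hp⟩ := ih ((maxDegree_mono (Finset.subset_insert e E)).trans h)
    obtain ⟨h1, h2⟩ := maxDegree_le_iff.1 h
    have h1 := h1 e.1
    have h2 := h2 e.2
    rw [Finset.filter_insert, if_pos rfl, Finset.card_insert_of_notMem (by simp [he])] at h1 h2
    set A := (E.filter fun e' => e'.1 = e.1) ∪ E.filter fun e' => e'.2 = e.2
    -- Each endpoint of `e` meets at most D - 1 other edges, so at most 2D - 2 colours are
    -- forbidden.
    have hA : (A.image f).card < (Finset.range (2 * D)).card := by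
      have h3 : (A.image f).card ≤ A.card := Finset.card_image_le
      have h4 : A.card ≤ _ := Finset.card_union_le _ _
      rw [Finset.card_range]
      omega
    obtain ⟨k, hk, hkA⟩ := Finset.exists_mem_notMem_of_card_lt_card hA
    have hkE : ∀ e' ∈ E, k = f e' → e'.1 ≠ e.1 ∧ e'.2 ≠ e.2 := by
      intro e' he' hk'
      constructor
      · intro h
        exact hkA (Finset.mem_image.2 ⟨e', by simp [A, he', h], hk'.symm⟩)
      · intro h
        exact hkA (Finset.mem_image.2 ⟨e', by simp [A, he', h], hk'.symm⟩)
    have hne : ∀ e' ∈ E, e' ≠ e := fun e' he' h => he (h ▸ he')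
    refine ⟨Function.update f e k, fun e' he' => ?_, fun e' he' e'' he'' hee hff => ?_⟩
    · rcases Finset.mem_insert.1 he' with rfl | he'
      · simpa using hk
      · rw [Function.update_of_ne (hne _ he')]; exact hf _ he'
    · rcases Finset.mem_insert.1 he' with rfl | hm <;>
        rcases Finset.mem_insert.1 he'' with rfl | hm'
      · exact absurd rfl hee
      · rw [Function.update_self, Function.update_of_ne (hne _ hm')] at hff
        obtain ⟨h3, h4⟩ := hkE _ hm' hff
        exact ⟨h3.symm, h4.symm⟩
      · rw [Function.update_self, Function.update_of_ne (hne _ hm)] at hff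
        exact hkE _ hm hff.symm
      · rw [Function.update_of_ne (hne _ hm'), Function.update_of_ne (hne _ hm)] at hff
        exact hp _ hm _ hm' hee hff

/-- Colour classes form a competing cover. König's theorem would remove the factor 2, which the
constant C absorbs. -/
theorem IsMinimalMatchingCover.card_le {M : Finset (Finset (Fin N × Fin K))}
    (h : IsMinimalMatchingCover E M) : M.card ≤ 2 * maxDegree E := by
  classical
  obtain ⟨f, hf, hp⟩ := exists_edge_colouring (le_refl (maxDegree E))
  refine (h.2.2 ((Finset.range (2 * maxDegree E)).image fun k => E.filter fun e => f e = k)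
    ?_ ?_).trans (Finset.card_image_le.trans (Finset.card_range _).le)
  · intro m hm
    obtain ⟨k, -, rfl⟩ := Finset.mem_image.1 hm
    intro e he e' he' hne
    rw [Finset.mem_filter] at he he'
    exact hp e he.1 e' he'.1 hne (he.2.trans he'.2.symm)
  · intro e he
    exact ⟨_, Finset.mem_image.2 ⟨f e, Finset.mem_range.2 (hf e he), rfl⟩,
      Finset.mem_filter.2 ⟨he, rfl⟩⟩

/-- Removing the pairs in increasing order of `τ` until the maximal degree drops. -/
theorem exists_degreeReducing (τ : Fin N × Fin K → ℕ) (hE : maxDegree E ≠ 0) :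
    ∃ s, DegreeReducing E s ∧ (∀ e ∈ E \ s, s.sup τ ≤ τ e) ∧
      ∀ s', s' ⊆ E → maxDegree (E \ s') < maxDegree E → s.sup τ ≤ s'.sup τ := by
  classical
  induction hn : E.card generalizing E with
  | zero =>
    rw [Finset.card_eq_zero.1 hn, maxDegree_empty] at hE
    exact absurd rfl hE
  | succ n ih =>
    have hne : E.Nonempty := Finset.card_pos.1 (by omega)
    obtain ⟨e, he, hmin⟩ := Finset.exists_min_image E τ hne
    -- A competitor is nonempty, so its maximum is at least the overall minimum τ e.
    have hmin' : ∀ s', s' ⊆ E → maxDegree (E \ s') < maxDegree E → τ e ≤ s'.sup τ := by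
      intro s' hs' hlt
      obtain ⟨f, hf⟩ : s'.Nonempty := by
        rw [Finset.nonempty_iff_ne_empty]
        rintro rfl
        simp at hlt
      exact (hmin f (hs' hf)).trans (Finset.le_sup hf)
    have hstep := maxDegree_le_erase_add_one (E := E) e
    by_cases hlt : maxDegree (E.erase e) < maxDegree E
    · refine ⟨{e}, ⟨by simpa using he, ?_⟩, ?_, ?_⟩
      · rw [Finset.sdiff_singleton_eq_erase]; omega
      · intro f hf
        rw [Finset.sup_singleton]
        exact hmin f (Finset.mem_sdiff.1 hf).1
      · intro s' hs' hlt'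
        rw [Finset.sup_singleton]
        exact hmin' s' hs' hlt'
    · have heq : maxDegree (E.erase e) = maxDegree E :=
        le_antisymm (maxDegree_mono (Finset.erase_subset _ _)) (not_lt.1 hlt)
      obtain ⟨s, hs, hlow, hs'⟩ := ih (E := E.erase e) (by omega)
        (by rw [Finset.card_erase_of_mem he]; omega)
      have hsd : E \ insert e s = E.erase e \ s := by
        ext f
        simp only [Finset.mem_sdiff, Finset.mem_insert, Finset.mem_erase]
        tauto
      refine ⟨insert e s, ⟨?_, ?_⟩, ?_, ?_⟩
      · exact Finset.insert_subset he (hs.1.trans (Finset.erase_subset _ _))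
      · rw [hsd, ← hs.2, heq]
      · intro f hf
        rw [hsd] at hf
        rw [Finset.sup_insert]
        exact sup_le (hmin f (Finset.mem_of_mem_erase (Finset.mem_sdiff.1 hf).1)) (hlow f hf)
      -- Without `e` the competitor still lowers the degree of `E.erase e`, which equals that of
      -- `E`, so induction applies.
      · intro s'' hs'' hlt'
        rw [Finset.sup_insert]
        refine sup_le (hmin' s'' hs'' hlt') ((hs' (s''.erase e) ?_ ?_).trans
          (Finset.sup_mono (Finset.erase_subset _ _)))
        · exact Finset.erase_subset_erase _ hs''
        · rw [heq]
          refine lt_of_le_of_lt (maxDegree_mono ?_) hlt'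
          intro f
          simp only [Finset.mem_sdiff, Finset.mem_erase]
          tauto

/-! ### Phase sequences and the degree of the remaining pairs -/

theorem remaining_succ (i : ℕ) : remaining r (i + 1) = remaining r i \ r i := by
  classical
  ext e
  simp only [remaining, Finset.mem_sdiff, Finset.mem_univ, Finset.mem_biUnion, Finset.mem_range,
    true_and, not_exists, not_and]
  constructor
  · exact fun h => ⟨fun j hj => h j (by omega), h i (by omega)⟩
  · rintro ⟨h1, h2⟩ j hj
    rcases Nat.lt_succ_iff_lt_or_eq.1 hj with hj | rfl
    · exact h1 j hj
    · exact h2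

theorem remaining_one (h : r 0 = ∅) : remaining r 1 = Finset.univ := by
  simp [remaining, h]

/-- Iterate the greedy choice: the degree starts at K and drops by one each time, so K choices are
possible. The order is chronological because a greedy choice leaves only pairs with elimination time
at least its maximum. -/
theorem exists_isPhaseSequence (hN : 1 ≤ N) (hNK : N ≤ K) (τ : Fin N × Fin K → ℕ) :
    ∃ r, IsPhaseSequence τ r := by
  classical
  have hex : ∀ E : Finset (Fin N × Fin K), ∃ s, maxDegree E ≠ 0 → DegreeReducing E s ∧
      (∀ e ∈ E \ s, s.sup τ ≤ τ e) ∧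
      ∀ s', s' ⊆ E → maxDegree (E \ s') < maxDegree E → s.sup τ ≤ s'.sup τ := by
    intro E
    by_cases h : maxDegree E = 0
    · exact ⟨∅, fun h' => absurd h h'⟩
    · obtain ⟨s, hs⟩ := exists_degreeReducing τ h
      exact ⟨s, fun _ => hs⟩
  choose pick hpick using hex
  let left : ℕ → Finset (Fin N × Fin K) := fun i => (fun E => E \ pick E)^[i] Finset.univ
  have left_succ : ∀ i, left (i + 1) = left i \ pick (left i) :=
    fun i => Function.iterate_succ_apply' _ _ _
  let r : ℕ → Finset (Fin N × Fin K) := fun i => if i = 0 then ∅ else pick (left (i - 1))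
  have r_succ : ∀ i, r (i + 1) = pick (left i) := fun i => by simp [r]
  have hrem : ∀ i, remaining r (i + 1) = left i := by
    intro i
    induction i with
    | zero => exact remaining_one rfl
    | succ i ih => rw [remaining_succ, ih, r_succ, left_succ]
  have hdeg : ∀ i, i ≤ K → maxDegree (left i) + i = K := by
    intro i
    induction i with
    | zero => intro _; exact maxDegree_univ hN hNK
    | succ i ih =>
      intro hi
      have h1 := ih (by omega)
      have h2 := (hpick (left i) (by omega)).1.2
      rw [left_succ]
      omega
  have hp : ∀ i, i < K → _ := fun i hi => hpick (left i) (by have := hdeg i hi.le; omega)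
  refine ⟨r, rfl, ?_, ?_, ?_⟩
  · intro i h1 hi
    obtain ⟨i, rfl⟩ := Nat.exists_eq_add_of_le' h1
    rw [hrem, r_succ]
    exact (hp i hi).1
  · intro i h1 hi s hs
    obtain ⟨i, rfl⟩ := Nat.exists_eq_add_of_le' h1
    rw [hrem] at hs
    rw [r_succ]
    exact (hp i hi).2.2 s hs.1 (by have := hs.2; omega)
  · intro i h1 hi
    obtain ⟨i, rfl⟩ := Nat.exists_eq_add_of_le' h1
    rw [r_succ, r_succ]
    have h2 := (hp (i + 1) hi).1
    obtain ⟨e, he⟩ : (pick (left (i + 1))).Nonempty := by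
      rw [Finset.nonempty_iff_ne_empty]
      intro h
      have := h2.2
      rw [h] at this
      simp at this
    have h3 := h2.1 he
    rw [left_succ] at h3
    exact ((hp i (by omega)).2.1 e h3).trans (Finset.le_sup he)

theorem IsPhaseSequence.maxDegree_remaining (h : IsPhaseSequence τ r) (hN : 1 ≤ N) (hNK : N ≤ K)
    {i : ℕ} (hi : i ≤ K) : maxDegree (remaining r (i + 1)) + i = K := by
  induction i with
  | zero => rw [remaining_one h.zero]; exact maxDegree_univ hN hNK
  | succ i ih =>
    have h1 := ih (by omega)
    have h2 := (h.reducing (i + 1) (by omega) hi).2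
    rw [remaining_succ]
    omega

theorem IsPhaseSequence.sup_le_sup (h : IsPhaseSequence τ r) {i j : ℕ} (hij : i ≤ j)
    (hj : j ≤ K) : (r i).sup τ ≤ (r j).sup τ := by
  induction j, hij using Nat.le_induction with
  | base => exact le_rfl
  | succ j hij ih =>
    refine (ih (by omega)).trans ?_
    rcases Nat.eq_zero_or_pos j with rfl | hpos
    · rw [h.zero]; simp
    · exact h.chronological j hpos (by omega)

theorem IsPhaseSequence.le_sup_last (h : IsPhaseSequence τ r) (hN : 1 ≤ N) (hNK : N ≤ K)
    (e : Fin N × Fin K) : τ e ≤ (r K).sup τ := by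
  have h1 := h.maxDegree_remaining hN hNK le_rfl
  have h2 : remaining r (K + 1) = ∅ := eq_empty_of_maxDegree_eq_zero (by omega)
  have h3 : e ∉ remaining r (K + 1) := by rw [h2]; simp
  simp only [remaining, Finset.mem_sdiff, Finset.mem_univ, true_and, not_not,
    Finset.mem_biUnion, Finset.mem_range] at h3
  obtain ⟨i, hi, he⟩ := h3
  exact (Finset.le_sup he).trans (h.sup_le_sup (by omega) le_rfl)

theorem IsPhaseSequence.exists_isPhaseIndex (h : IsPhaseSequence τ r) (hN : 1 ≤ N) (hNK : N ≤ K)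
    (F : Finset (Fin N × Fin K)) : ∃ n, IsPhaseIndex τ r (F.sup τ) n := by
  have hex : ∃ n, F.sup τ ≤ (r (n + 1)).sup τ :=
    ⟨K - 1, by
      rw [Nat.sub_add_cancel (by omega)]
      exact Finset.sup_le fun e _ => h.le_sup_last hN hNK e⟩
  classical
  refine ⟨Nat.find hex + 1, by omega, ?_, ?_, Nat.find_spec hex⟩
  · have : Nat.find hex ≤ K - 1 := Nat.find_min' hex (by
      rw [Nat.sub_add_cancel (by omega)]
      exact Finset.sup_le fun e _ => h.le_sup_last hN hNK e)
    omega
  · rw [Nat.add_sub_cancel]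
    rcases Nat.eq_zero_or_pos (Nat.find hex) with h0 | hpos
    · rw [h0, h.zero]; simp
    · have := Nat.find_min hex (show Nat.find hex - 1 < Nat.find hex by omega)
      rw [Nat.sub_add_cancel hpos] at this
      omega

/-- Phase maxima are nondecreasing, so the phases finished by time `t` are the first `A.card` ones;
`E` avoids them, and each lowered the degree by one. -/
theorem IsPhaseSequence.maxDegree_add_card_le (h : IsPhaseSequence τ r) (hN : 1 ≤ N)
    (hNK : N ≤ K) {n t : ℕ} (hn : n ≤ K) (hE : ∀ e ∈ E, t < τ e) :
    maxDegree E + ((Finset.Icc 1 n).filter fun s => (r s).sup τ ≤ t).card ≤ K := by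
  classical
  set A := (Finset.Icc 1 n).filter fun s => (r s).sup τ ≤ t with hA
  have hcard : A.card ≤ n := (Finset.card_filter_le _ _).trans (by simp)
  have hsub : E ⊆ remaining r (A.card + 1) := by
    intro e he
    simp only [remaining, Finset.mem_sdiff, Finset.mem_univ, true_and, Finset.mem_biUnion,
      Finset.mem_range, not_exists, not_and]
    intro i hi her
    -- Otherwise `A` lies in [1, i) and has fewer than `i` elements.
    obtain ⟨s, hs, his⟩ : ∃ s ∈ A, i ≤ s := by
      by_contra! hcon
      have h1 : A ⊆ Finset.Ico 1 i := fun s hs => by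
        have h2 := hcon s hs
        rw [hA, Finset.mem_filter, Finset.mem_Icc] at hs
        rw [Finset.mem_Ico]
        omega
      have h2 := Finset.card_le_card h1
      rw [Nat.card_Ico] at h2
      rcases Nat.eq_zero_or_pos i with rfl | hpos
      · rw [h.zero] at her
        simp at her
      · omega
    rw [hA, Finset.mem_filter, Finset.mem_Icc] at hs
    have h1 : τ e ≤ _ := Finset.le_sup her
    have h2 := h.sup_le_sup his (by omega)
    have h3 := hE e he
    omega
  have h1 := maxDegree_mono hsub
  have h2 := h.maxDegree_remaining hN hNK (hcard.trans hn)
  omega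

/-- Phase `s` < `n` is finished during `tmax - (r s).sup τ` of the times below `tmax`; subtracting
these savings from `K * tmax` leaves the right-hand side. -/
theorem IsPhaseSequence.sum_maxDegree_le (h : IsPhaseSequence τ r) (hN : 1 ≤ N) (hNK : N ≤ K)
    {n T tmax : ℕ} (hn : IsPhaseIndex τ r tmax n) (hT : T ≤ tmax)
    {E : ℕ → Finset (Fin N × Fin K)} (hE : ∀ t < T, ∀ e ∈ E t, t < τ e) :
    ∑ t ∈ Finset.range T, maxDegree (E t) ≤
      ∑ s ∈ Finset.Icc 1 (n - 1), (r s).sup τ + (K + 1 - n) * tmax := by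
  classical
  obtain ⟨hn1, hnK, hlow, -⟩ := hn
  set A : ℕ → ℕ := fun t => ((Finset.Icc 1 (n - 1)).filter fun s => (r s).sup τ ≤ t).card
  have hA : ∀ t, A t ≤ K := fun t => (Finset.card_filter_le _ _).trans (by simp; omega)
  have h1 : ∑ t ∈ Finset.range T, maxDegree (E t) ≤ ∑ t ∈ Finset.range tmax, (K - A t) := by
    refine (Finset.sum_le_sum fun t ht => ?_).trans
      (Finset.sum_le_sum_of_subset (Finset.range_subset_range.2 hT))
    have := h.maxDegree_add_card_le hN hNK (n := n - 1) (by omega) (hE t (Finset.mem_range.1 ht))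
    change _ + A t ≤ K at this
    omega
  have h2 : ∑ t ∈ Finset.range tmax, (K - A t) + ∑ t ∈ Finset.range tmax, A t = tmax * K := by
    rw [← Finset.sum_add_distrib,
      Finset.sum_congr rfl fun t _ => Nat.sub_add_cancel (hA t)]
    simp
  have h3 : ∑ t ∈ Finset.range tmax, A t =
      ∑ s ∈ Finset.Icc 1 (n - 1), (tmax - (r s).sup τ) := by
    simp only [A, Finset.card_filter]
    rw [Finset.sum_comm]
    refine Finset.sum_congr rfl fun s _ => ?_
    rw [← Finset.card_filter, show ((Finset.range tmax).filter fun t => (r s).sup τ ≤ t) =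
      Finset.Ico ((r s).sup τ) tmax by ext; simp; tauto, Nat.card_Ico]
  have h4 : ∑ s ∈ Finset.Icc 1 (n - 1), (tmax - (r s).sup τ) +
      ∑ s ∈ Finset.Icc 1 (n - 1), (r s).sup τ = (n - 1) * tmax := by
    rw [← Finset.sum_add_distrib, Finset.sum_congr rfl fun s hs => Nat.sub_add_cancel
      ((h.sup_le_sup (Finset.mem_Icc.1 hs).2 (by omega)).trans hlow)]
    simp
  have h5 : tmax * K = (n - 1) * tmax + (K + 1 - n) * tmax := by
    rw [← add_mul, mul_comm]
    congr 1
    omega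
  omega

end Degrees

/-! ### Confidence radii and elimination times -/

section Radii

variable {N K : ℕ} {δ : ℝ}

theorem confRadius_nonneg (t : ℕ) : 0 ≤ confRadius N K δ t := Real.sqrt_nonneg _

theorem log_radicand_eq (hN : 1 ≤ N) (hK : 1 ≤ K) (hδ : 0 < δ) {t : ℕ} (ht : 1 ≤ t) :
    Real.log (4 * K * N * (t : ℝ) ^ 2 / δ) =
      2 * Real.log 2 + Real.log (K * N / δ) + 2 * Real.log t := by
  have hN' : (0 : ℝ) < N := by exact_mod_cast hN
  have hK' : (0 : ℝ) < K := by exact_mod_cast hK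
  have ht' : (0 : ℝ) < t := by exact_mod_cast ht
  rw [show 4 * (K : ℝ) * N * (t : ℝ) ^ 2 / δ = (2 : ℝ) ^ 2 * (K * N / δ) * (t : ℝ) ^ 2 by ring,
    Real.log_mul (by positivity) (by positivity), Real.log_mul (by positivity) (by positivity),
    Real.log_pow, Real.log_pow]
  norm_num

theorem log_mul_div_nonneg (hN : 1 ≤ N) (hK : 1 ≤ K) (hδ : 0 < δ) (hδ1 : δ < 1) :
    0 ≤ Real.log (K * N / δ) := by
  have hN' : (1 : ℝ) ≤ N := by exact_mod_cast hN
  have hK' : (1 : ℝ) ≤ K := by exact_mod_cast hK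
  apply Real.log_nonneg
  rw [le_div_iff₀ hδ]
  nlinarith

theorem log_radicand_pos (hN : 1 ≤ N) (hK : 1 ≤ K) (hδ : 0 < δ) (hδ1 : δ < 1) {t : ℕ}
    (ht : 1 ≤ t) : 0 < Real.log (4 * K * N * (t : ℝ) ^ 2 / δ) := by
  rw [log_radicand_eq hN hK hδ ht]
  have h1 := log_mul_div_nonneg hN hK hδ hδ1
  have h2 : 0 ≤ Real.log t := Real.log_natCast_nonneg t
  have h3 := Real.log_two_gt_d9
  linarith

/-- Reduces to t(log(t+1) - log t) ≤ log 2 + log t: an equality at t = 1; for t ≥ 2 the left side is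
at most 1 ≤ 2 log 2. -/
theorem confRadius_succ_le (hN : 1 ≤ N) (hK : 1 ≤ K) (hδ : 0 < δ) (hδ1 : δ < 1) {t : ℕ}
    (ht : 1 ≤ t) : confRadius N K δ (t + 1) ≤ confRadius N K δ t := by
  apply Real.sqrt_le_sqrt
  rw [log_radicand_eq hN hK hδ ht, log_radicand_eq hN hK hδ (Nat.le_add_left 1 t)]
  have ht' : (1 : ℝ) ≤ t := by exact_mod_cast ht
  have h1 := log_mul_div_nonneg hN hK hδ hδ1
  have h3 := Real.log_two_gt_d9
  push_cast
  rw [div_le_div_iff₀ (by positivity) (by positivity)]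
  set l := Real.log (K * N / δ)
  suffices h : t * (Real.log (t + 1) - Real.log t) ≤ Real.log 2 + Real.log t by
    nlinarith
  rcases Nat.eq_or_lt_of_le ht with rfl | ht2
  · norm_num
  · have ht2' : (2 : ℝ) ≤ t := by exact_mod_cast ht2
    have h4 : Real.log 2 ≤ Real.log t := Real.log_le_log (by norm_num) ht2'
    have h5 : Real.log (t + 1) - Real.log t ≤ 1 / t := by
      rw [← Real.log_div (by positivity) (by positivity)]
      refine (Real.log_le_sub_one_of_pos (by positivity)).trans (le_of_eq ?_)
      field_simp
      ring
    have h6 : t * (Real.log (t + 1) - Real.log t) ≤ t * (1 / t) :=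
      mul_le_mul_of_nonneg_left h5 (by positivity)
    rw [mul_one_div_cancel (by positivity)] at h6
    linarith

theorem exists_four_mul_confRadius_lt (hN : 1 ≤ N) (hK : 2 ≤ K) (hδ : 0 < δ) (hδ1 : δ < 1)
    {D : ℝ} (hD : 0 < D) (hD1 : D ≤ 1) :
    ∃ t : ℕ, 1 ≤ t ∧ 4 * confRadius N K δ t < D ∧
      (t : ℝ) ≤ 512 * (Real.log (K * N / (δ * D)) / D ^ 2) := by
  have hN' : (1 : ℝ) ≤ N := by exact_mod_cast hN
  have hK' : (2 : ℝ) ≤ K := by exact_mod_cast hK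
  set L := Real.log (K * N / (δ * D)) with hL
  have hLeq : L = Real.log (K * N / δ) - Real.log D := by
    rw [hL, ← div_div, Real.log_div (by positivity) (by positivity)]
  have hlogD : Real.log D ≤ 0 := Real.log_nonpos hD.le hD1
  have hl2 : Real.log 2 ≤ Real.log (K * N / δ) := by
    apply Real.log_le_log (by norm_num)
    rw [le_div_iff₀ hδ]
    nlinarith
  have h2 := Real.log_two_gt_d9
  have hL2 : Real.log 2 ≤ L := by linarith
  have hLpos : 0 < L := by linarith
  have hD2 : 0 < D ^ 2 := by positivity
  have hD21 : D ^ 2 ≤ 1 := pow_le_one₀ hD.le hD1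
  -- With t = ⌈B⌉ ≤ 2B the goal is 2 log 2 + log(KN/δ) + 2 log t < tD²/8. The right side is at least
  -- 32L; the left is below 23L, by log L ≤ L - 1, log 2 ≤ L and -log D ≤ L - log 2.
  set B := 256 * (L / D ^ 2) with hB
  have hBL : 256 * L = B * D ^ 2 := by rw [hB]; field_simp
  have hB1 : 1 ≤ B := by nlinarith
  have hceil := Nat.ceil_lt_add_one (show 0 ≤ B by linarith)
  have hle := Nat.le_ceil B
  refine ⟨⌈B⌉₊, Nat.one_le_ceil_iff.2 (by linarith), ?_, by linarith⟩
  set t := ⌈B⌉₊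
  have ht1 : 1 ≤ t := Nat.one_le_ceil_iff.2 (by linarith)
  have htpos : (0 : ℝ) < t := by linarith
  suffices h : confRadius N K δ t < D / 4 by linarith
  unfold confRadius
  rw [Real.sqrt_lt' (by positivity), log_radicand_eq hN (by omega) hδ ht1,
    div_lt_iff₀ (by positivity)]
  have hlogt : Real.log t ≤ 9 * Real.log 2 + Real.log L - 2 * Real.log D := by
    have h1 : Real.log t ≤ Real.log ((2 : ℝ) ^ 9 * L / D ^ 2) := by
      apply Real.log_le_log htpos
      rw [mul_div_assoc]
      norm_num
      linarith
    rw [Real.log_div (by positivity) (by positivity), Real.log_mul (by positivity) hLpos.ne',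
      Real.log_pow, Real.log_pow] at h1
    norm_num at h1
    linarith
  have hlogL : Real.log L ≤ L - 1 := Real.log_le_sub_one_of_pos hLpos
  have hkey : 256 * L ≤ t * D ^ 2 := by
    rw [hBL]
    exact mul_le_mul_of_nonneg_right hle hD2.le
  nlinarith

/-! ### Gaps and elimination times -/

variable {μ : Fin N → Fin K → ℝ}

theorem exists_gap_eq (hK : 2 ≤ K) (p : Fin N) (a : Fin K) :
    ∃ j, j ≠ a ∧ gap μ p a = |μ p a - μ p j| := by
  have : Nontrivial (Fin K) := Fin.nontrivial_iff_two_le.2 hK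
  obtain ⟨j, hj⟩ := exists_ne a
  have : Nonempty {j : Fin K // j ≠ a} := ⟨⟨j, hj⟩⟩
  obtain ⟨i, hi⟩ := exists_eq_ciInf_of_finite (f := fun j : {j : Fin K // j ≠ a} => |μ p a - μ p j|)
  exact ⟨i, i.2, hi.symm⟩

theorem gap_le (p : Fin N) {a j : Fin K} (hj : j ≠ a) : gap μ p a ≤ |μ p a - μ p j| :=
  ciInf_le (Set.finite_range fun j : {j : Fin K // j ≠ a} => |μ p a - μ p j|).bddBelow ⟨j, hj⟩

theorem exists_elim_le (hN : 1 ≤ N) (hK : 2 ≤ K) (hδ : 0 < δ) (hδ1 : δ < 1)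
    (hinj : ∀ p, Function.Injective (μ p)) (hμ : ∀ p a, μ p a ∈ Set.Icc (0 : ℝ) 1)
    (p : Fin N) (a : Fin K) :
    ∃ t : ℕ, (1 ≤ t ∧ ∀ j, j ≠ a → 4 * confRadius N K δ t < |μ p a - μ p j|) ∧
      (t : ℝ) ≤ 512 * (Real.log (K * N / (δ * gap μ p a)) / gap μ p a ^ 2) := by
  obtain ⟨j, hj, hgap⟩ := exists_gap_eq (μ := μ) hK p a
  have h0 : 0 < gap μ p a := by
    rw [hgap, abs_pos, sub_ne_zero]
    exact fun h => hj (hinj p h).symm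
  have h1 : gap μ p a ≤ 1 := by
    obtain ⟨ha0, ha1⟩ := hμ p a
    obtain ⟨hj0, hj1⟩ := hμ p j
    rw [hgap, abs_le]
    constructor <;> linarith
  obtain ⟨t, ht, hlt, hle⟩ := exists_four_mul_confRadius_lt hN hK hδ hδ1 h0 h1
  exact ⟨t, ⟨ht, fun j hj => hlt.trans_le (gap_le p hj)⟩, hle⟩

theorem elimTime_le (hN : 1 ≤ N) (hK : 2 ≤ K) (hδ : 0 < δ) (hδ1 : δ < 1)
    (hinj : ∀ p, Function.Injective (μ p)) (hμ : ∀ p a, μ p a ∈ Set.Icc (0 : ℝ) 1)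
    (p : Fin N) (a : Fin K) :
    (elimTime δ μ (p, a) : ℝ) ≤
      512 * (Real.log (K * N / (δ * gap μ p a)) / gap μ p a ^ 2) := by
  obtain ⟨t, ht, hle⟩ := exists_elim_le hN hK hδ hδ1 hinj hμ p a
  exact (Nat.cast_le.2 (Nat.sInf_le ht)).trans hle

theorem elimTime_spec (hN : 1 ≤ N) (hK : 1 ≤ K) (hδ : 0 < δ) (hδ1 : δ < 1)
    (hinj : ∀ p, Function.Injective (μ p)) (hμ : ∀ p a, μ p a ∈ Set.Icc (0 : ℝ) 1)
    (p : Fin N) (a : Fin K) :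
    1 ≤ elimTime δ μ (p, a) ∧
      ∀ j, j ≠ a → 4 * confRadius N K δ (elimTime δ μ (p, a)) < |μ p a - μ p j| := by
  have hne : {t : ℕ | 1 ≤ t ∧ ∀ j, j ≠ a → 4 * confRadius N K δ t < |μ p a - μ p j|}.Nonempty := by
    -- A single arm has no competitor, so t = 1 qualifies vacuously.
    rcases Nat.eq_or_lt_of_le hK with rfl | hK2
    · exact ⟨1, le_rfl, fun j hj => absurd (Subsingleton.elim j a) hj⟩
    · obtain ⟨t, ht, -⟩ := exists_elim_le hN hK2 hδ hδ1 hinj hμ p a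
      exact ⟨t, ht⟩
  exact Nat.sInf_mem hne

end Radii

/-! ### Sorting -/

section Sorting

variable {K : ℕ} {f g : Fin K → ℝ}

theorem card_filter_symm_lt (σ : Equiv.Perm (Fin K)) (a : Fin K) :
    (Finset.univ.filter fun b => σ.symm b < σ.symm a).card = σ.symm a := by
  rw [show (Finset.univ.filter fun b => σ.symm b < σ.symm a) =
    (Finset.Iio (σ.symm a)).map σ.toEmbedding by
      ext b; simp [Finset.mem_map_equiv], Finset.card_map, Fin.card_Iio]

/-- An arm whose comparisons with all other arms are the same for `f` and `g` has the same position
in both rankings. -/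
theorem symm_eq_of_compare {π σ : Equiv.Perm (Fin K)} (hπ : StrictAnti fun i => f (π i))
    (hσ : Antitone fun i => g (σ i)) {a : Fin K}
    (h : ∀ b, (f b < f a → g b < g a) ∧ (f a < f b → g a < g b)) : σ.symm a = π.symm a := by
  have hf : ∀ {b c}, π.symm b < π.symm c → f c < f b := fun {b c} hbc => by
    simpa using hπ hbc
  have hg : ∀ {b c}, g c < g b → σ.symm b < σ.symm c := fun {b c} hbc => by
    by_contra hcon
    have := hσ (not_lt.1 hcon)
    simp only [Equiv.apply_symm_apply] at this
    exact absurd hbc (not_lt.2 this)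
  have hiff : ∀ b, σ.symm b < σ.symm a ↔ π.symm b < π.symm a := by
    intro b
    refine ⟨fun hb => ?_, fun hb => hg ((h b).2 (hf hb))⟩
    by_contra hcon
    rcases eq_or_lt_of_le (not_lt.1 hcon) with heq | hlt
    · rw [π.symm.injective heq] at hb
      exact lt_irrefl _ hb
    · exact lt_asymm hb (hg ((h b).1 (hf hlt)))
  -- A position is the number of arms ranked ahead.
  apply Fin.ext
  rw [← card_filter_symm_lt, ← card_filter_symm_lt]
  simp only [hiff]

end Sorting

/-! ### Runs of the algorithm with accurate sample means -/

section Run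

variable {N K : ℕ} {δ : ℝ} {μ : Fin N → Fin K → ℝ} {x : Fin N → Fin K → ℕ → ℝ}
  {ρ : Fin K → Equiv.Perm (Fin N)} {srt : (Fin K → ℝ) → Equiv.Perm (Fin K)}
  {cover : Finset (Fin N × Fin K) → Finset (Finset (Fin N × Fin K))}
  {π : Fin N → Equiv.Perm (Fin K)}

/-- The mean of the first `t` rewards. -/
noncomputable def sampleMean (x : Fin N → Fin K → ℕ → ℝ) (t : ℕ) (p : Fin N) (a : Fin K) : ℝ :=
  (∑ i ∈ Finset.range t, x p a i) / t

/-- All sample means lie within the confidence radius of the true means. -/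
def AccurateRewards (δ : ℝ) (μ : Fin N → Fin K → ℝ) (x : Fin N → Fin K → ℕ → ℝ) : Prop :=
  ∀ t, 1 ≤ t → ∀ p a, |sampleMean x t p a - μ p a| ≤ confRadius N K δ t

theorem Icc_inter_Icc_eq_empty_iff {u v e : ℝ} (he : 0 ≤ e) :
    Set.Icc (u - e) (u + e) ∩ Set.Icc (v - e) (v + e) = ∅ ↔ 2 * e < |u - v| := by
  rw [Set.Icc_inter_Icc, Set.Icc_eq_empty_iff, not_le, lt_abs]
  simp only [min_def, max_def]
  split_ifs <;> constructor <;> intro h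
  all_goals first
    | (rcases h with h | h <;> linarith)
    | (by_cases huv : u ≤ v
       · right; linarith
       · left; linarith)

theorem active_succ (t : ℕ) : (algState δ ρ srt cover x (t + 1)).active =
    eliminate δ (t + 1) (algState δ ρ srt cover x t).active
      (algState δ ρ srt cover x (t + 1)).est := rfl

theorem active_succ_subset (t : ℕ) :
    (algState δ ρ srt cover x (t + 1)).active ⊆ (algState δ ρ srt cover x t).active := by
  classical
  exact Finset.filter_subset _ _

theorem est_succ_of_mem {t : ℕ} {p : Fin N} {a : Fin K}
    (h : (p, a) ∈ (algState δ ρ srt cover x t).active) :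
    (algState δ ρ srt cover x (t + 1)).est p a = sampleMean x (t + 1) p a := if_pos h

theorem est_succ_of_notMem {t : ℕ} {p : Fin N} {a : Fin K}
    (h : (p, a) ∉ (algState δ ρ srt cover x t).active) :
    (algState δ ρ srt cover x (t + 1)).est p a = (algState δ ρ srt cover x t).est p a := if_neg h

theorem notMem_active_succ_iff {t : ℕ} {p : Fin N} {a : Fin K}
    (ha : (p, a) ∈ (algState δ ρ srt cover x t).active) :
    (p, a) ∉ (algState δ ρ srt cover x (t + 1)).active ↔
      ∀ b, b ≠ a → (p, b) ∈ (algState δ ρ srt cover x t).active →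
        2 * confRadius N K δ (t + 1) <
          |sampleMean x (t + 1) p a - sampleMean x (t + 1) p b| := by
  classical
  rw [active_succ, eliminate, Finset.mem_filter]
  simp only [ha, true_and, not_not]
  refine forall_congr' fun b => imp_congr_right fun _ => forall_congr' fun hb => ?_
  rw [confInterval, confInterval, Icc_inter_Icc_eq_empty_iff (confRadius_nonneg _),
    est_succ_of_mem ha, est_succ_of_mem hb]

theorem one_le_of_notMem_active {t : ℕ} {e : Fin N × Fin K}
    (h : e ∉ (algState δ ρ srt cover x t).active) : 1 ≤ t := by
  rcases Nat.eq_zero_or_pos t with rfl | h'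
  · exact absurd (Finset.mem_univ e) h
  · exact h'

/-- The estimate of an eliminated pair compares correctly with the other estimates, now and at any
later time. -/
theorem est_separated (hN : 1 ≤ N) (hK : 1 ≤ K) (hδ : 0 < δ) (hδ1 : δ < 1)
    (hx : AccurateRewards δ μ x) (t : ℕ) (p : Fin N) (a b : Fin K) (hab : μ p b < μ p a) :
    ((p, a) ∉ (algState δ ρ srt cover x t).active →
      (p, b) ∈ (algState δ ρ srt cover x t).active →
      μ p b + confRadius N K δ t < (algState δ ρ srt cover x t).est p a) ∧
    ((p, a) ∈ (algState δ ρ srt cover x t).active →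
      (p, b) ∉ (algState δ ρ srt cover x t).active →
      (algState δ ρ srt cover x t).est p b < μ p a - confRadius N K δ t) ∧
    ((p, a) ∉ (algState δ ρ srt cover x t).active →
      (p, b) ∉ (algState δ ρ srt cover x t).active →
      (algState δ ρ srt cover x t).est p b < (algState δ ρ srt cover x t).est p a) := by
  induction t with
  | zero =>
    exact ⟨fun h => absurd (Finset.mem_univ _) h, fun _ h => absurd (Finset.mem_univ _) h,
      fun h => absurd (Finset.mem_univ _) h⟩
  | succ t ih =>
    obtain ⟨ih1, ih2, ih3⟩ := ih
    have hsub := active_succ_subset (δ := δ) (ρ := ρ) (srt := srt) (cover := cover) (x := x) t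
    obtain ⟨ha1, ha2⟩ := abs_le.1 (hx (t + 1) (by omega) p a)
    obtain ⟨hb1, hb2⟩ := abs_le.1 (hx (t + 1) (by omega) p b)
    have hε := confRadius_nonneg (N := N) (K := K) (δ := δ) (t + 1)
    -- Fails from t = 0, where the radius is 0 by division by zero; but nothing has been eliminated
    -- then.
    have hmono : 1 ≤ t → confRadius N K δ (t + 1) ≤ confRadius N K δ t :=
      confRadius_succ_le hN hK hδ hδ1
    have hne : b ≠ a := fun h => by rw [h] at hab; exact lt_irrefl _ hab
    -- Disjoint intervals separate the sample means by more than twice the radius; with errors of at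
    -- most one radius each, the order must be the true one.
    have hsep : (p, a) ∈ (algState δ ρ srt cover x t).active →
        (p, b) ∈ (algState δ ρ srt cover x t).active →
        ((p, a) ∉ (algState δ ρ srt cover x (t + 1)).active ∨
          (p, b) ∉ (algState δ ρ srt cover x (t + 1)).active) →
        sampleMean x (t + 1) p b + 2 * confRadius N K δ (t + 1) < sampleMean x (t + 1) p a := by
      intro ha hb h
      have h' : 2 * confRadius N K δ (t + 1) <
          |sampleMean x (t + 1) p a - sampleMean x (t + 1) p b| := by
        rcases h with h | h
        · exact (notMem_active_succ_iff ha).1 h b hne hb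
        · rw [abs_sub_comm]
          exact (notMem_active_succ_iff hb).1 h a hne.symm ha
      rcases lt_abs.1 h' with h' | h' <;> linarith
    by_cases ha : (p, a) ∈ (algState δ ρ srt cover x t).active <;>
      by_cases hb : (p, b) ∈ (algState δ ρ srt cover x t).active
    · rw [est_succ_of_mem ha, est_succ_of_mem hb]
      refine ⟨fun h1 _ => ?_, fun _ h2 => ?_, fun h1 _ => ?_⟩
      · have := hsep ha hb (Or.inl h1); linarith
      · have := hsep ha hb (Or.inr h2); linarith
      · have := hsep ha hb (Or.inl h1); linarith
    · rw [est_succ_of_mem ha, est_succ_of_notMem hb]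
      have h1 := ih2 ha hb
      have h2 := hmono (one_le_of_notMem_active hb)
      exact ⟨fun _ h => absurd (hsub h) hb, fun _ _ => by linarith, fun _ _ => by linarith⟩
    · rw [est_succ_of_notMem ha, est_succ_of_mem hb]
      have h1 := ih1 ha hb
      have h2 := hmono (one_le_of_notMem_active ha)
      exact ⟨fun _ _ => by linarith, fun h => absurd (hsub h) ha, fun _ _ => by linarith⟩
    · rw [est_succ_of_notMem ha, est_succ_of_notMem hb]
      exact ⟨fun _ h => absurd (hsub h) hb, fun h => absurd (hsub h) ha, fun _ _ => ih3 ha hb⟩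

/-- The frozen estimate clears the other arm's true mean by one radius, which bounds the error of an
estimate still being updated. -/
theorem est_lt_est (hN : 1 ≤ N) (hK : 1 ≤ K) (hδ : 0 < δ) (hδ1 : δ < 1)
    (hx : AccurateRewards δ μ x) {t : ℕ} {p : Fin N} {a b : Fin K} (hab : μ p b < μ p a)
    (h : (p, a) ∉ (algState δ ρ srt cover x t).active ∨
      (p, b) ∉ (algState δ ρ srt cover x t).active) :
    (algState δ ρ srt cover x t).est p b < (algState δ ρ srt cover x t).est p a := by
  have ht : 1 ≤ t := h.elim one_le_of_notMem_active one_le_of_notMem_active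
  obtain ⟨h1, h2, h3⟩ := est_separated (ρ := ρ) (srt := srt) (cover := cover) hN hK hδ hδ1 hx t p
    a b hab
  have hest : ∀ c, (p, c) ∈ (algState δ ρ srt cover x t).active →
      |(algState δ ρ srt cover x t).est p c - μ p c| ≤ confRadius N K δ t := by
    intro c hc
    obtain ⟨s, rfl⟩ := Nat.exists_eq_add_of_le' ht
    rw [est_succ_of_mem (active_succ_subset s hc)]
    exact hx _ ht p c
  by_cases ha : (p, a) ∈ (algState δ ρ srt cover x t).active <;>
    by_cases hb : (p, b) ∈ (algState δ ρ srt cover x t).active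
  · tauto
  · have := h2 ha hb
    have := abs_le.1 (hest a ha)
    linarith
  · have := h1 ha hb
    have := abs_le.1 (hest b hb)
    linarith
  · exact h3 ha hb

/-- An eliminated arm has the same position in the estimated and in the true ranking. -/
theorem symm_srt_est_eq (hN : 1 ≤ N) (hK : 1 ≤ K) (hδ : 0 < δ) (hδ1 : δ < 1)
    (hsrt : IsArgsort srt) (hπ : ∀ p, StrictAnti fun i => μ p (π p i))
    (hx : AccurateRewards δ μ x) {t : ℕ} {p : Fin N} {a : Fin K}
    (h : (p, a) ∉ (algState δ ρ srt cover x t).active) :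
    (srt ((algState δ ρ srt cover x t).est p)).symm a = (π p).symm a :=
  symm_eq_of_compare (hπ p) (hsrt _) fun _ =>
    ⟨fun hlt => est_lt_est hN hK hδ hδ1 hx hlt (Or.inl h),
      fun hlt => est_lt_est hN hK hδ hδ1 hx hlt (Or.inr h)⟩

/-! ### Stopping, correctness and cost -/

theorem pending_succ (t : ℕ) : (algState δ ρ srt cover x (t + 1)).pending =
    upToPartner (fun p => srt ((algState δ ρ srt cover x (t + 1)).est p))
      (deferredAcceptance (fun p => srt ((algState δ ρ srt cover x (t + 1)).est p)) ρ)
      (algState δ ρ srt cover x (t + 1)).active := rfl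

theorem matching_succ (t : ℕ) : (algState δ ρ srt cover x (t + 1)).matching =
    deferredAcceptance (fun p => srt ((algState δ ρ srt cover x (t + 1)).est p)) ρ := rfl

/-- When the algorithm stops, it returns the optimal stable matching. -/
theorem matching_eq_of_pending_eq_empty (hN : 1 ≤ N) (hK : 1 ≤ K) (hδ : 0 < δ) (hδ1 : δ < 1)
    (hsrt : IsArgsort srt) (hπ : ∀ p, StrictAnti fun i => μ p (π p i))
    (hx : AccurateRewards δ μ x) {t : ℕ} (h : (algState δ ρ srt cover x t).pending = ∅) :
    (algState δ ρ srt cover x t).matching = deferredAcceptance π ρ := by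
  obtain _ | t := t
  · have h0 : ((⟨0, hN⟩, ⟨0, hK⟩) : Fin N × Fin K) ∈ (algState δ ρ srt cover x 0).pending :=
      Finset.mem_univ _
    rw [h] at h0
    exact absurd h0 (Finset.notMem_empty _)
  rw [matching_succ]
  symm
  -- The prefix read is that of the run on the estimated lists, which is what the stopping rule
  -- sees.
  apply deferredAcceptance_congr
  intro p i hi
  rw [pending_succ] at h
  have hnot : (p, srt ((algState δ ρ srt cover x (t + 1)).est p) i) ∉
      (algState δ ρ srt cover x (t + 1)).active := by
    intro hmem
    refine Finset.notMem_empty _ (h ▸ mem_upToPartner_deferredAcceptance.2 ⟨hmem, ?_⟩)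
    rwa [Equiv.symm_apply_apply]
  have := symm_srt_est_eq hN hK hδ hδ1 hsrt hπ hx hnot
  rw [Equiv.symm_apply_apply, Equiv.eq_symm_apply] at this
  exact this.symm

/-- After its elimination time, a pair is not available any more. -/
theorem notMem_active_of_elimTime_le (hN : 1 ≤ N) (hK : 1 ≤ K) (hδ : 0 < δ) (hδ1 : δ < 1)
    (hinj : ∀ p, Function.Injective (μ p)) (hμ : ∀ p a, μ p a ∈ Set.Icc (0 : ℝ) 1)
    (hx : AccurateRewards δ μ x) {t : ℕ} {e : Fin N × Fin K} (h : elimTime δ μ e ≤ t) :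
    e ∉ (algState δ ρ srt cover x t).active := by
  obtain ⟨p, a⟩ := e
  induction t, h using Nat.le_induction with
  | base =>
    obtain ⟨h1, h2⟩ := elimTime_spec hN hK hδ hδ1 hinj hμ p a
    obtain ⟨s, hs⟩ := Nat.exists_eq_add_of_le' h1
    rw [hs] at h2 ⊢
    by_cases ha : (p, a) ∈ (algState δ ρ srt cover x s).active
    · rw [notMem_active_succ_iff ha]
      intro b hb _
      -- A true gap above four radii leaves a sample gap above two.
      have h3 := h2 b hb
      obtain ⟨ha1, ha2⟩ := abs_le.1 (hx (s + 1) (by omega) p a)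
      obtain ⟨hb1, hb2⟩ := abs_le.1 (hx (s + 1) (by omega) p b)
      rw [lt_abs] at h3 ⊢
      rcases h3 with h3 | h3
      · left; linarith
      · right; linarith
    · exact fun h => ha (active_succ_subset s h)
  | succ t _ ih => exact fun h => ih (active_succ_subset t h)

/-- By t_max every arm read by the run on the true lists has been removed and sits at its true
position in the estimated list. So the run on the estimated lists is the same and reads only removed
arms. -/
theorem pending_eq_empty (hN : 1 ≤ N) (hK : 1 ≤ K) (hδ : 0 < δ) (hδ1 : δ < 1)
    (hsrt : IsArgsort srt) (hπ : ∀ p, StrictAnti fun i => μ p (π p i))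
    (hinj : ∀ p, Function.Injective (μ p)) (hμ : ∀ p a, μ p a ∈ Set.Icc (0 : ℝ) 1)
    (hx : AccurateRewards δ μ x) :
    (algState δ ρ srt cover x (maxElimTime (elimTime δ μ) π (deferredAcceptance π ρ))).pending =
      ∅ := by
  have hle : ∀ p (i : Fin K), (i : ℕ) ≤ daFinal π ρ p → elimTime δ μ (p, π p i) ≤
      maxElimTime (elimTime δ μ) π (deferredAcceptance π ρ) := by
    intro p i hi
    refine Finset.le_sup (f := elimTime δ μ)
      (mem_upToPartner_deferredAcceptance.2 ⟨Finset.mem_univ _, ?_⟩)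
    rwa [Equiv.symm_apply_apply]
  have hpos := (elimTime_spec hN hK hδ hδ1 hinj hμ ⟨0, hN⟩ (π ⟨0, hN⟩ ⟨0, hK⟩)).1.trans
    (hle _ _ (Nat.zero_le _))
  obtain ⟨t, ht⟩ := Nat.exists_eq_add_of_le' hpos
  rw [ht] at hle ⊢
  have hnot : ∀ p (i : Fin K), (i : ℕ) ≤ daFinal π ρ p →
      (p, π p i) ∉ (algState δ ρ srt cover x (t + 1)).active := fun p i hi =>
    notMem_active_of_elimTime_le hN hK hδ hδ1 hinj hμ hx (hle p i hi)
  have hagree : ∀ p (i : Fin K), (i : ℕ) ≤ daFinal π ρ p →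
      π p i = srt ((algState δ ρ srt cover x (t + 1)).est p) i := by
    intro p i hi
    have h1 := symm_srt_est_eq hN hK hδ hδ1 hsrt hπ hx (hnot p i hi)
    rw [Equiv.symm_apply_apply, Equiv.symm_apply_eq] at h1
    exact h1
  rw [pending_succ, Finset.eq_empty_iff_forall_notMem]
  rintro ⟨p, a⟩ ha
  rw [mem_upToPartner_deferredAcceptance, daFinal_congr hagree] at ha
  obtain ⟨ha, hle'⟩ := ha
  have h1 := hnot p _ hle'
  rw [hagree p _ hle', Equiv.apply_symm_apply] at h1
  exact h1 ha

theorem cost_eq (t : ℕ) : (algState δ ρ srt cover x t).cost =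
    ∑ s ∈ Finset.range t, (cover (algState δ ρ srt cover x s).active).card := by
  induction t with
  | zero => rfl
  | succ t ih => rw [Finset.sum_range_succ, ← ih]; rfl

theorem returns_of_accurateRewards (hN : 1 ≤ N) (hNK : N ≤ K) (hδ : 0 < δ) (hδ1 : δ < 1)
    (hsrt : IsArgsort srt) (hcover : ∀ E, IsMinimalMatchingCover E (cover E))
    (hπ : ∀ p, StrictAnti fun i => μ p (π p i))
    (hinj : ∀ p, Function.Injective (μ p)) (hμ : ∀ p a, μ p a ∈ Set.Icc (0 : ℝ) 1)
    (hx : AccurateRewards δ μ x) :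
    ∃ c, Returns δ ρ srt cover x (deferredAcceptance π ρ) c ∧
      ∀ r n, IsPhaseSequence (elimTime δ μ) r →
        IsPhaseIndex (elimTime δ μ) r
          (maxElimTime (elimTime δ μ) π (deferredAcceptance π ρ)) n →
        c ≤ 2 * (∑ s ∈ Finset.Icc 1 (n - 1), (r s).sup (elimTime δ μ) +
          (K + 1 - n) * maxElimTime (elimTime δ μ) π (deferredAcceptance π ρ)) := by
  classical
  have hK : 1 ≤ K := hN.trans hNK
  have hpend := pending_eq_empty (ρ := ρ) (cover := cover) hN hK hδ hδ1 hsrt hπ hinj hμ hx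
  have hex : ∃ T, (algState δ ρ srt cover x T).pending = ∅ := ⟨_, hpend⟩
  refine ⟨_, ⟨Nat.find hex, Nat.find_spec hex, fun t ht =>
    Finset.nonempty_iff_ne_empty.2 (Nat.find_min hex ht),
    matching_eq_of_pending_eq_empty hN hK hδ hδ1 hsrt hπ hx (Nat.find_spec hex), rfl⟩,
    fun r n hr hn => ?_⟩
  rw [cost_eq]
  refine (Finset.sum_le_sum fun t _ => (hcover _).card_le).trans ?_
  rw [← Finset.mul_sum]
  refine Nat.mul_le_mul_left 2 (hr.sum_maxDegree_le hN hNK hn (Nat.find_min' hex hpend) ?_)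
  intro t _ e he
  by_contra hcon
  exact notMem_active_of_elimTime_le hN hK hδ hδ1 hinj hμ hx (not_lt.1 hcon) he

end Run

/-! ### Concentration of the sample means -/

section Concentration

variable {N K : ℕ} {Ω : Type*} [MeasurableSpace Ω] {P : Measure Ω}
  {δ : ℝ} {ν : Fin N → Fin K → Measure ℝ} {X : Fin N → Fin K → ℕ → Ω → ℝ}

theorem IsRewardModel.integral_eq (hX : IsRewardModel P ν X) (p : Fin N) (a : Fin K) (i : ℕ) :
    ∫ ω, X p a i ω ∂P = meanReward ν p a := by
  rw [meanReward, ← hX.law p a i]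
  exact (integral_map (hX.measurable p a i).aemeasurable aestronglyMeasurable_id).symm

theorem IsRewardModel.ae_mem_Icc (hX : IsRewardModel P ν X) (p : Fin N) (a : Fin K) (i : ℕ) :
    ∀ᵐ ω ∂P, X p a i ω ∈ Set.Icc (0 : ℝ) 1 := by
  have h := hX.range p a
  rw [← hX.law p a i] at h
  exact ae_of_ae_map (hX.measurable p a i).aemeasurable h

theorem IsRewardModel.meanReward_mem_Icc [IsProbabilityMeasure P] (hX : IsRewardModel P ν X)
    (p : Fin N) (a : Fin K) :
    meanReward ν p a ∈ Set.Icc (0 : ℝ) 1 := by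
  rw [← hX.integral_eq p a 0]
  have h := hX.ae_mem_Icc p a 0
  have hint : Integrable (X p a 0) P :=
    Integrable.of_mem_Icc 0 1 (hX.measurable p a 0).aemeasurable h
  constructor
  · exact integral_nonneg_of_ae (h.mono fun ω hω => hω.1)
  · calc ∫ ω, X p a 0 ω ∂P ≤ ∫ _ω, (1 : ℝ) ∂P :=
          integral_mono_ae hint (integrable_const 1) (h.mono fun ω hω => hω.2)
      _ = 1 := by simp

/-- Hoeffding's inequality, for both tails. -/
theorem measure_lt_abs_sum_range_div_sub_le [IsProbabilityMeasure P] {Y : ℕ → Ω → ℝ}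
    {m : ℝ} (hY : ∀ i, Measurable (Y i))
    (hindep : iIndepFun Y P) (hrange : ∀ i, ∀ᵐ ω ∂P, Y i ω ∈ Set.Icc (0 : ℝ) 1)
    (hmean : ∀ i, ∫ ω, Y i ω ∂P = m) {t : ℕ} (ht : 1 ≤ t) {ε : ℝ} (hε : 0 ≤ ε) :
    P {ω | ε < |(∑ i ∈ Finset.range t, Y i ω) / t - m|} ≤
      ENNReal.ofReal (2 * Real.exp (-(2 * t * ε ^ 2))) := by
  have htpos : (0 : ℝ) < t := by exact_mod_cast ht
  have hsub : ∀ i, HasSubgaussianMGF (fun ω => Y i ω - m) ((‖(1 : ℝ) - 0‖₊ / 2) ^ 2) P := by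
    intro i
    have := hasSubgaussianMGF_of_mem_Icc (hY i).aemeasurable (hrange i)
    rwa [hmean i] at this
  have hind : iIndepFun (fun i ω => Y i ω - m) P :=
    hindep.comp (fun _ y => y - m) fun _ => measurable_id.sub_const m
  have hind' : iIndepFun (fun i => -(fun ω => Y i ω - m)) P :=
    hindep.comp (fun _ y => -(y - m)) fun _ => (measurable_id.sub_const m).neg
  -- A variable in [0, 1] has sub-Gaussian variance proxy 1/4.
  have hexp : -(t * ε) ^ 2 / (2 * t * (((‖(1 : ℝ) - 0‖₊ / 2) ^ 2 : NNReal) : ℝ)) =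
      -(2 * t * ε ^ 2) := by
    simp only [sub_zero, nnnorm_one, NNReal.coe_pow, NNReal.coe_div, NNReal.coe_one,
      NNReal.coe_ofNat]
    field_simp
  have h1 := HasSubgaussianMGF.measure_sum_range_ge_le_of_iIndepFun hind (n := t)
    (fun i _ => hsub i) (ε := t * ε) (by positivity)
  have h2 := HasSubgaussianMGF.measure_sum_range_ge_le_of_iIndepFun hind' (n := t)
    (fun i _ => (hsub i).neg) (ε := t * ε) (by positivity)
  rw [hexp] at h1 h2
  have hcover : {ω | ε < |(∑ i ∈ Finset.range t, Y i ω) / t - m|} ⊆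
      {ω | t * ε ≤ ∑ i ∈ Finset.range t, (Y i ω - m)} ∪
        {ω | t * ε ≤ ∑ i ∈ Finset.range t, (-(fun ω => Y i ω - m)) ω} := by
    intro ω hω
    simp only [Set.mem_ofPred_eq, Set.mem_union, Pi.neg_apply, Finset.sum_neg_distrib,
      Finset.sum_sub_distrib, Finset.sum_const, Finset.card_range, nsmul_eq_mul] at hω ⊢
    set S := ∑ i ∈ Finset.range t, Y i ω
    have hS : S - t * m = t * (S / t - m) := by field_simp
    rw [hS, ← mul_neg]
    rcases lt_abs.1 hω with h | h
    · exact Or.inl (mul_le_mul_of_nonneg_left h.le htpos.le)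
    · exact Or.inr (mul_le_mul_of_nonneg_left h.le htpos.le)
  refine (measure_mono hcover).trans ((measure_union_le _ _).trans ?_)
  rw [two_mul, ENNReal.ofReal_add (Real.exp_nonneg _) (Real.exp_nonneg _)]
  exact add_le_add ((ENNReal.le_ofReal_iff_toReal_le (measure_ne_top _ _) (Real.exp_nonneg _)).2 h1)
    ((ENNReal.le_ofReal_iff_toReal_le (measure_ne_top _ _) (Real.exp_nonneg _)).2 h2)

theorem two_mul_exp_confRadius (hN : 1 ≤ N) (hK : 1 ≤ K) (hδ : 0 < δ) (hδ1 : δ < 1) {t : ℕ}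
    (ht : 1 ≤ t) : 2 * Real.exp (-(2 * t * confRadius N K δ t ^ 2)) =
      δ / (2 * K * N) * (1 / (t : ℝ) ^ 2) := by
  have hN' : (0 : ℝ) < N := by exact_mod_cast hN
  have hK' : (0 : ℝ) < K := by exact_mod_cast hK
  have ht' : (0 : ℝ) < t := by exact_mod_cast ht
  have hlog := log_radicand_pos hN hK hδ hδ1 ht
  rw [confRadius, Real.sq_sqrt (by positivity), mul_div_cancel₀ _ (by positivity),
    Real.exp_neg, Real.exp_log (by positivity)]
  field_simp
  norm_num

theorem tsum_one_div_succ_sq_le : ∑' t : ℕ, 1 / ((t + 1 : ℕ) : ℝ) ^ 2 ≤ 2 := by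
  have h := hasSum_zeta_two
  have h1 := h.summable.tsum_eq_zero_add
  rw [h.tsum_eq] at h1
  simp only [Nat.cast_zero, ne_eq, OfNat.ofNat_ne_zero, not_false_eq_true, zero_pow, div_zero,
    zero_add] at h1
  rw [← h1]
  have h2 := Real.pi_lt_d2
  have h3 := Real.pi_pos
  nlinarith

/-- The union runs over all t and all pairs, including samples that are never drawn, so the adaptive
choice of pairs plays no role. -/
theorem IsRewardModel.measure_not_accurateRewards_le [IsProbabilityMeasure P]
    (hX : IsRewardModel P ν X) (hN : 1 ≤ N) (hK : 1 ≤ K) (hδ : 0 < δ) (hδ1 : δ < 1) :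
    P {ω | ¬ AccurateRewards δ (meanReward ν) fun p a i => X p a i ω} ≤ ENNReal.ofReal δ := by
  have hN' : (0 : ℝ) < N := by exact_mod_cast hN
  have hK' : (0 : ℝ) < K := by exact_mod_cast hK
  have hcover : {ω | ¬ AccurateRewards δ (meanReward ν) fun p a i => X p a i ω} ⊆
      ⋃ t : ℕ, ⋃ e : Fin N × Fin K, {ω | confRadius N K δ (t + 1) <
        |(∑ i ∈ Finset.range (t + 1), X e.1 e.2 i ω) / (t + 1 : ℕ) - meanReward ν e.1 e.2|} := by
    intro ω hω
    simp only [AccurateRewards, sampleMean, Set.mem_ofPred_eq, not_forall, not_le] at hω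
    obtain ⟨t, ht, p, a, h⟩ := hω
    obtain ⟨s, rfl⟩ := Nat.exists_eq_add_of_le' ht
    exact Set.mem_iUnion₂.2 ⟨s, (p, a), h⟩
  have hsum : Summable fun t : ℕ => 1 / ((t + 1 : ℕ) : ℝ) ^ 2 :=
    (summable_nat_add_iff 1).2 hasSum_zeta_two.summable
  calc P {ω | ¬ AccurateRewards δ (meanReward ν) fun p a i => X p a i ω}
      ≤ ∑' t : ℕ, ∑' _e : Fin N × Fin K,
          ENNReal.ofReal (δ / (2 * K * N) * (1 / ((t + 1 : ℕ) : ℝ) ^ 2)) := by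
        refine (measure_mono hcover).trans ((measure_iUnion_le _).trans
          (ENNReal.tsum_le_tsum fun t => (measure_iUnion_le _).trans
            (ENNReal.tsum_le_tsum fun e => ?_)))
        rw [← two_mul_exp_confRadius hN hK hδ hδ1 (Nat.le_add_left 1 t)]
        exact measure_lt_abs_sum_range_div_sub_le (hX.measurable e.1 e.2) (hX.indep e.1 e.2)
          (hX.ae_mem_Icc e.1 e.2) (hX.integral_eq e.1 e.2) (Nat.le_add_left 1 t)
          (confRadius_nonneg _)
    _ = ∑' t : ℕ, ENNReal.ofReal (δ / 2 * (1 / ((t + 1 : ℕ) : ℝ) ^ 2)) := by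
        refine tsum_congr fun t => ?_
        rw [tsum_fintype, Finset.sum_const, Finset.card_univ, Fintype.card_prod, Fintype.card_fin,
          Fintype.card_fin, ← ENNReal.ofReal_nsmul, nsmul_eq_mul]
        congr 1
        push_cast
        field_simp
    _ = ENNReal.ofReal (δ / 2 * ∑' t : ℕ, 1 / ((t + 1 : ℕ) : ℝ) ^ 2) := by
        rw [← ENNReal.ofReal_tsum_of_nonneg (fun t => by positivity) (hsum.mul_left _),
          tsum_mul_left]
    _ ≤ ENNReal.ofReal δ := by
        apply ENNReal.ofReal_le_ofReal
        nlinarith [tsum_one_div_succ_sq_le]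

end Concentration

/-! ### The main theorem -/

theorem theorem3 :
    ∃ C : ℝ, 0 < C ∧
      ∀ (N K : ℕ), 1 ≤ N → N ≤ K →
      ∀ (δ : ℝ), 0 < δ → δ < 1 →
      -- the preferences of the arms, and the routines used by the algorithm
      ∀ (ρ : Fin K → Equiv.Perm (Fin N))
        (srt : (Fin K → ℝ) → Equiv.Perm (Fin K)), IsArgsort srt →
      ∀ (cover : Finset (Fin N × Fin K) → Finset (Finset (Fin N × Fin K))),
        (∀ E, IsMinimalMatchingCover E (cover E)) →
      -- the reward distributions; `π p` lists the arms by strictly decreasing mean reward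
      ∀ (ν : Fin N → Fin K → Measure ℝ) (π : Fin N → Equiv.Perm (Fin K)),
        (∀ p, StrictAnti fun i => meanReward ν p (π p i)) →
      ∀ (Ω : Type*) [MeasurableSpace Ω] (P : Measure Ω) [IsProbabilityMeasure P]
        (X : Fin N → Fin K → ℕ → Ω → ℝ), IsRewardModel P ν X →
      -- `mstar` is the unique player-optimal stable matching
      ∃ mstar : Finset (Fin N × Fin K),
        (∀ m, IsPlayerOptimalStable π ρ m ↔ m = mstar) ∧
        -- the order of the elimination times
        (2 ≤ K → ∀ p a, (elimTime δ (meanReward ν) (p, a) : ℝ) ≤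
          C * (Real.log (K * N / (δ * gap (meanReward ν) p a)) /
            gap (meanReward ν) p a ^ 2)) ∧
        -- the algorithm stops and returns `mstar` with probability at least `1 - δ`
        P {ω | ¬ ∃ c, Returns δ ρ srt cover (fun p a i => X p a i ω) mstar c} ≤
          ENNReal.ofReal δ ∧
        -- the sets `r s` and the index `n` exist
        (∃ r n, IsPhaseSequence (elimTime δ (meanReward ν)) r ∧
          IsPhaseIndex (elimTime δ (meanReward ν)) r
            (maxElimTime (elimTime δ (meanReward ν)) π mstar) n) ∧
        -- with probability at least `1 - δ`, it does so within the stated number of matchings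
        ∀ r n, IsPhaseSequence (elimTime δ (meanReward ν)) r →
          IsPhaseIndex (elimTime δ (meanReward ν)) r
            (maxElimTime (elimTime δ (meanReward ν)) π mstar) n →
          P {ω | ¬ ∃ c, Returns δ ρ srt cover (fun p a i => X p a i ω) mstar c ∧
              (c : ℝ) ≤ C * ((∑ s ∈ Finset.Icc 1 (n - 1),
                  (((r s).sup (elimTime δ (meanReward ν)) : ℕ) : ℝ)) +
                ((K : ℝ) - n + 1) * maxElimTime (elimTime δ (meanReward ν)) π mstar)} ≤
            ENNReal.ofReal δ := by
  -- The elimination times dictate 512; the number of matchings only needs 2.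
  refine ⟨512, by norm_num, ?_⟩
  intro N K hN hNK δ hδ hδ1 ρ srt hsrt cover hcover ν π hπ Ω _ P _ X hX
  have hK : 1 ≤ K := hN.trans hNK
  have hμ := hX.meanReward_mem_Icc
  have hinj : ∀ p, Function.Injective (meanReward ν p) := fun p => by
    have h := (hπ p).injective.comp (π p).symm.injective
    simpa only [Function.comp_def, Equiv.apply_symm_apply] using h
  have hgood := hX.measure_not_accurateRewards_le hN hK hδ hδ1
  have hret := fun ω => returns_of_accurateRewards (x := fun p a i => X p a i ω) (ρ := ρ)
    hN hNK hδ hδ1 hsrt hcover hπ hinj hμ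
  refine ⟨deferredAcceptance π ρ, fun m => isPlayerOptimalStable_iff, fun hK2 p a =>
    elimTime_le hN hK2 hδ hδ1 hinj hμ p a, ?_, ?_, ?_⟩
  -- Failure lies inside the inaccurate event; monotonicity of `P` needs no measurability.
  · refine (measure_mono ?_).trans hgood
    intro ω hω hacc
    apply hω
    obtain ⟨c, hc, -⟩ := hret ω hacc
    exact ⟨c, hc⟩
  · obtain ⟨r, hr⟩ := exists_isPhaseSequence hN hNK (elimTime δ (meanReward ν))
    obtain ⟨n, hn⟩ := hr.exists_isPhaseIndex hN hNK
      (upToPartner π (deferredAcceptance π ρ) Finset.univ)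
    exact ⟨r, n, hr, hn⟩
  · intro r n hr hn
    refine (measure_mono ?_).trans hgood
    intro ω hω hacc
    apply hω
    obtain ⟨c, hc, hle⟩ := hret ω hacc
    refine ⟨c, hc, ?_⟩
    have h1 : (c : ℝ) ≤ _ := Nat.cast_le.2 (hle r n hr hn)
    have h2 : n ≤ K + 1 := hn.2.1.trans (Nat.le_succ K)
    push_cast [Nat.cast_sub h2] at h1 ⊢
    rw [show (K : ℝ) - n + 1 = K + 1 - n by ring]
    refine h1.trans (mul_le_mul_of_nonneg_right (by norm_num) ?_)
    have h3 : (n : ℝ) ≤ K + 1 := by exact_mod_cast h2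
    have h4 : (0 : ℝ) ≤ K + 1 - n := by linarith
    positivity
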